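/- **Notation.** For $\mathrm{Im}\,\tau>0$ let $\theta(\lambda,\tau)=-\sum_{n\in\mathbb Z+1/2}e^{\pi i(n^2\tau+n(2\lambda+1))}$. For $k\in\mathbb Z_{\ge0}$ let $\Theta_k(\tau)$ be the space of entire functions $f$ with $f(\lambda+2r+2s\tau)=e^{-2\pi i k(s^2\tau+s\lambda)}f(\lambda)$ for all $r,s\in\mathbb Z$. For an integer $\kappa\ge4$ let $E_\kappa(\tau,\eta)$ be the space of odd functions in $\Theta_{\kappa+2}(\tau)$ vanishing on $2\eta j+\mathbb Z+\mathbb Z\tau$ for $j=-1,0,1$. For $\mathrm{Im}\,\tau,\mathrm{Im}\,\sigma>0$ put $$\Omega_{2\eta}(t,\tau,\sigma)=\prod_{j,k=0}^\infty\frac{(1-e^{2\pi i(t-2\eta+j\tau+k\sigma)})(1-e^{2\pi i(-t-2\eta+(j+1)\tau+(k+1)\sigma)})}{(1-e^{2\pi i(t+2\eta+j\tau+k\sigma)})(1-e^{2\pi i(-t+2\eta+(j+1)\tau+(k+1)\sigma)})},$$ and, for $\mathrm{Im}\,\eta>0$, $$u(\lambda,\mu,\tau,\sigma,\eta)=e^{-\frac{\pi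 i\lambda\mu}{2\eta}}\int_0^1\Omega_{2\eta}(t,\tau,\sigma)\frac{\theta(\lambda+t,\tau)\,\theta(\mu+t,\sigma)}{\theta(t-2\eta,\tau)\,\theta(t-2\eta,\sigma)}\,dt .$$ For general $\eta$, $u$ is defined by analytic continuation in $\eta$, with $\lambda,\mu,\tau,\sigma$ fixed, to the connected set $R(\tau,\sigma)$ of all $\eta\in\mathbb C$ such that $4\eta+l+m\tau+n\sigma\ne0$ for all $l\in\mathbb Z$ and $m,n\in\mathbb Z_{\ge0}$. Further let $$Q(\mu,\sigma,\eta)=\frac{\theta(4\eta,\sigma)\,\theta'(0,\sigma)}{\theta(\mu-2\eta,\sigma)\,\theta(\mu+2\eta,\sigma)}$$ (the prime is the derivative in the first argument), $$(U(\tau,\sigma,\eta)v)(\lambda)=\int_{\eta\mathbb R}u(\lambda,\mu,\tau,\sigma,\eta)\,Q(\mu,\sigma,\eta)\,v(-\mu)\,d\mu ,$$ let $\alpha(\eta)$ be multiplication by $\alpha(\lambda,\eta)=\exp(-\pi i\lambda^2/4\eta)$, and let $$T_\kappa(\tau,\eta)=-\frac{e^{4\pi i\eta}}{2\pi\sqrt{4i\eta}}\;\alpha(\eta)\,U(\tau,\tau-2\eta\kappa,\eta)\,\alpha(\eta)$$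 (principal square root; the line $\eta\mathbb R$ is parametrized by $\mu=\eta x$, with $x$ running from $-\infty$ to $\infty$). **Proposition.** Let $\kappa\ge4$ be an integer, $\mathrm{Im}\,\tau>0$, $\mathrm{Im}\,\eta<0$, and $j\tau+4\eta\notin\mathbb Z$ for every $j=1,2,\dots$. Put $\sigma=\tau-2\eta\kappa$. Then for all $\lambda,\mu\in\mathbb C$ the integral over $[0,1]$ converges for $\mathrm{Im}\,\eta'>0$ and the function $\eta'\mapsto u(\lambda,\mu,\tau,\sigma,\eta')$ continues analytically to $R(\tau,\sigma)$; moreover $\eta\in R(\tau,\sigma)$. For every $f\in E_\kappa(\tau-2\eta\kappa,\eta)$ the integral over $\mu\in\eta\mathbb R$ defining $(T_\kappa(\tau,\eta)f)(\lambda)$ converges absolutely for every $\lambda\in\mathbb C$, and $T_\kappa(\tau,\eta)f\in E_\kappa(\tau,\eta)$. Thus $T_\kappa(\tau,\eta)$ maps $E_\kappa(\tau-2\eta\kappa,\eta)$ to $E_\kappa(\tau,\eta)$. -/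

import Mathlib

noncomputable section

namespace HypTheta

open Complex MeasureTheory Topology

/-- Jacobi's first theta function
`θ(z, τ) = - ∑_{n ∈ ℤ + 1/2} exp (π i (n² τ + n (2 z + 1)))`. -/
def theta (z τ : ℂ) : ℂ :=
  -∑' n : ℤ, exp (Real.pi * I * (((n : ℂ) + 1 / 2) ^ 2 * τ + ((n : ℂ) + 1 / 2) * (2 * z + 1)))

/-- The space `Θ_k(τ)` of theta functions of level `k`: entire functions `f` with
`f (z + 2 r + 2 s τ) = exp (-2 π i k (s² τ + s z)) f z` for all integers `r, s`. -/
def Theta (k : ℤ) (τ : ℂ) : Submodule ℂ (ℂ → ℂ) where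
  carrier := {f | Differentiable ℂ f ∧ ∀ (r s : ℤ) (z : ℂ),
    f (z + 2 * r + 2 * s * τ) = exp (-(2 * Real.pi * I * k * ((s : ℂ) ^ 2 * τ + s * z))) * f z}
  zero_mem' := ⟨differentiable_const 0, by simp⟩
  add_mem' := by
    rintro f g ⟨hf, hf'⟩ ⟨hg, hg'⟩
    refine ⟨hf.add hg, fun r s z => ?_⟩
    simp only [Pi.add_apply, hf', hg']
    ring
  smul_mem' := by
    rintro c f ⟨hf, hf'⟩
    refine ⟨hf.const_smul c, fun r s z => ?_⟩
    simp only [Pi.smul_apply, smul_eq_mul, hf']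
    ring

/-- The space `E_κ(τ, η)`: odd theta functions of level `κ + 2` vanishing on
`2 η j + ℤ + ℤ τ` for `j = -1, 0, 1`. -/
def E (κ : ℤ) (τ η : ℂ) : Submodule ℂ (ℂ → ℂ) where
  carrier := {f | f ∈ Theta (κ + 2) τ ∧ (∀ z, f (-z) = -f z) ∧
    ∀ j : ℤ, -1 ≤ j → j ≤ 1 → ∀ r s : ℤ, f (2 * η * j + r + s * τ) = 0}
  zero_mem' := ⟨Submodule.zero_mem _, by simp, by simp⟩
  add_mem' := by
    rintro f g ⟨hf, hf', hf''⟩ ⟨hg, hg', hg''⟩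
    refine ⟨Submodule.add_mem _ hf hg, fun z => ?_, fun j h1 h2 r s => ?_⟩
    · simp only [Pi.add_apply, hf', hg']
      ring
    · simp only [Pi.add_apply, hf'' j h1 h2, hg'' j h1 h2, add_zero]
  smul_mem' := by
    rintro c f ⟨hf, hf', hf''⟩
    refine ⟨Submodule.smul_mem _ c hf, fun z => ?_, fun j h1 h2 r s => ?_⟩
    · simp only [Pi.smul_apply, smul_eq_mul, hf']
      ring
    · simp only [Pi.smul_apply, hf'' j h1 h2, smul_zero]

/-- The phase function `Ω_a(t, τ, σ)` (used with `a = 2 η`), an absolutely convergent product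
over pairs `(j, k)` of natural numbers. -/
def Omega (a t τ σ : ℂ) : ℂ :=
  ∏' p : ℕ × ℕ,
    ((1 - exp (2 * Real.pi * I * (t - a + p.1 * τ + p.2 * σ))) *
      (1 - exp (2 * Real.pi * I * (-t - a + (p.1 + 1) * τ + (p.2 + 1) * σ)))) /
    ((1 - exp (2 * Real.pi * I * (t + a + p.1 * τ + p.2 * σ))) *
      (1 - exp (2 * Real.pi * I * (-t + a + (p.1 + 1) * τ + (p.2 + 1) * σ))))

/-- The integrand in `t` of the hypergeometric integral. -/
def uIntegrand (z μ τ σ η t : ℂ) : ℂ :=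
  Omega (2 * η) t τ σ * (theta (z + t) τ * theta (μ + t) σ) /
    (theta (t - 2 * η) τ * theta (t - 2 * η) σ)

/-- The hypergeometric integral over the path `[0, 1]`; this is the definition of
`u(z, μ, τ, σ, η)` for `Im η > 0`. -/
def uUpper (z μ τ σ η : ℂ) : ℂ :=
  exp (-(Real.pi * I * z * μ / (2 * η))) *
    ∫ t in (0 : ℝ)..1, uIntegrand z μ τ σ η (t : ℂ)

/-- The values of `η` off the polar divisors `4 η + l + m τ + n σ = 0`
(`l ∈ ℤ`, `m, n ∈ ℤ_{≥ 0}`). -/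
def regularSet (τ σ : ℂ) : Set ℂ :=
  {η | ∀ (l : ℤ) (m n : ℕ), 4 * η + l + m * τ + n * σ ≠ 0}

/-- `F` is the analytic continuation in `η` of the hypergeometric integral, from the upper
half plane (where the integral over `[0, 1]` converges) to the whole of `regularSet τ σ`. -/
structure IsContinuation (z μ τ σ : ℂ) (F : ℂ → ℂ) : Prop where
  analytic : AnalyticOnNhd ℂ F (regularSet τ σ)
  integrable : ∀ η : ℂ, 0 < η.im →
    IntervalIntegrable (fun t : ℝ => uIntegrand z μ τ σ η (t : ℂ)) volume 0 1
  eq_upper : ∀ η : ℂ, 0 < η.im → F η = uUpper z μ τ σ η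

open Classical in
/-- The hypergeometric integral `u(z, μ, τ, σ, η)` for general `η`, by analytic continuation.
The value on `regularSet τ σ` does not depend on the choice, see `u_eq`. -/
def u (z μ τ σ η : ℂ) : ℂ :=
  if h : ∃ F : ℂ → ℂ, IsContinuation z μ τ σ F then h.choose η else 0

lemma isPreconnected_regularSet (τ σ : ℂ) : IsPreconnected (regularSet τ σ) := by
  have hc : (Set.range fun p : ℤ × ℕ × ℕ =>
      -((p.1 : ℂ) + p.2.1 * τ + p.2.2 * σ) / 4).Countable := Set.countable_range _
  have hE : regularSet τ σ = (Set.range fun p : ℤ × ℕ × ℕ =>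
      -((p.1 : ℂ) + p.2.1 * τ + p.2.2 * σ) / 4)ᶜ := by
    ext η
    simp only [regularSet, Set.mem_ofPred_eq, Set.mem_compl_iff, Set.mem_range, Prod.exists,
      not_exists, ne_eq]
    refine forall_congr' fun l => forall_congr' fun m => forall_congr' fun n => not_congr ?_
    constructor
    · intro h
      linear_combination -h / 4
    · intro h
      linear_combination -4 * h
  rw [hE]
  exact (hc.isConnected_compl_of_one_lt_rank (by simp [Complex.rank_real_complex])).isPreconnected

lemma upper_subset_regularSet {τ σ : ℂ} (hτ : 0 < τ.im) (hσ : 0 < σ.im) {η : ℂ}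
    (hη : 0 < η.im) : η ∈ regularSet τ σ := by
  intro l m n h
  have h' := congrArg Complex.im h
  simp at h'
  have h1 : 0 ≤ (m : ℝ) * τ.im := by positivity
  have h2 : 0 ≤ (n : ℝ) * σ.im := by positivity
  linarith

/-- Uniqueness of the analytic continuation: any continuation computes `u`. -/
lemma u_eq {τ σ : ℂ} (hτ : 0 < τ.im) (hσ : 0 < σ.im) {z μ : ℂ} {F : ℂ → ℂ}
    (hF : IsContinuation z μ τ σ F) {η : ℂ} (hη : η ∈ regularSet τ σ) :
    u z μ τ σ η = F η := by
  have h : ∃ F : ℂ → ℂ, IsContinuation z μ τ σ F := ⟨F, hF⟩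
  have hI : (0 : ℝ) < (I : ℂ).im := by simp
  have hev : h.choose =ᶠ[𝓝 I] F := by
    filter_upwards [(isOpen_lt continuous_const Complex.continuous_im).mem_nhds hI] with w hw
    rw [h.choose_spec.eq_upper w hw, hF.eq_upper w hw]
  rw [u, dif_pos h]
  exact h.choose_spec.analytic.eqOn_of_preconnected_of_eventuallyEq hF.analytic
    (isPreconnected_regularSet τ σ) (upper_subset_regularSet hτ hσ hI) hev hη

/-- `Q(μ, σ, η) = θ(4η, σ) θ'(0, σ) / (θ(μ - 2η, σ) θ(μ + 2η, σ))`. -/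
def Q (μ σ η : ℂ) : ℂ :=
  theta (4 * η) σ * deriv (fun x => theta x σ) 0 /
    (theta (μ - 2 * η) σ * theta (μ + 2 * η) σ)

/-- The pull-back to `x ∈ ℝ`, along `μ = η x`, `dμ = η dx`, of the integrand
`u(z, μ, τ, σ, η) Q(μ, σ, η) v(-μ) dμ` of the operator `U`. -/
def UIntegrand (τ σ η : ℂ) (v : ℂ → ℂ) (z : ℂ) (x : ℝ) : ℂ :=
  u z (η * x) τ σ η * Q (η * x) σ η * v (-(η * x)) * η

/-- The integral operator `U(τ, σ, η)`, integration being over the line `η ℝ`. -/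
def U (τ σ η : ℂ) (v : ℂ → ℂ) : ℂ → ℂ :=
  fun z => ∫ x : ℝ, UIntegrand τ σ η v z x

/-- Multiplication by the Gaussian `α(z, η) = exp (-π i z² / (4 η))`. -/
def alpha (η : ℂ) (v : ℂ → ℂ) : ℂ → ℂ :=
  fun z => exp (-(Real.pi * I * z ^ 2 / (4 * η))) * v z

/-- The operator `T_κ(τ, η) = - e^{4 π i η} / (2 π √(4 i η)) α(η) U(τ, τ - 2 η κ, η) α(η)`, with
the principal square root (`Re (4 i η) > 0` when `Im η < 0`). -/
def T (κ : ℤ) (τ η : ℂ) (f : ℂ → ℂ) : ℂ → ℂ :=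
  (-(exp (4 * Real.pi * I * η) / (2 * Real.pi * (4 * I * η) ^ (1 / 2 : ℂ)))) •
    alpha η (U τ (τ - 2 * η * κ) η (alpha η f))

end HypTheta

end

/-! Put σ = τ − 2ηκ and write u = exp(−πi zμ/2η) Φ(z, μ). The two Gaussians α and this exponential
complete a square, so T f(z) is, up to a constant, the integral over ηℝ of exp(−πi(z+μ)²/4η) Φ(z, μ)
h(μ), with h(μ) = Q(μ) f(−μ). The zeros of f at ±2η + ℤ + ℤσ cancel the poles of Q, and h is an odd
theta function of level κ − 2 (`exists_entire_Q_mul`).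

In μ, Φ grows like a theta function of level 2 up to exp(b|Im μ|), so Φ h grows like level κ.
Because 2κ(−Im η) = Im σ − Im τ, the Gaussian wins along ηℝ, by a margin proportional to Im τ
(`exists_bound_gaussKernel`). This gives absolute convergence, holomorphy in z, and freedom to
translate the line of integration. Moving z by 2r + 2sτ and μ by −(2r + 2sσ) changes z + μ by 4sηκ;
the resulting multipliers in μ cancel and those in z have level κ + 2 (`gaussInt_shift`). Oddness
comes from Φ(−z, −μ) = Φ(z, μ), and with quasi-periodicity it forces zeros on ℤ + ℤτ. The zeros on
2η + ℤ + ℤτ come from the resonance relation: exp(−πiμ) Φ(2η, μ) is even in μ, so a suitable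
translate of the integrand is odd (`gaussInt_resonance`).

It remains to control Φ when Im η < 0. For Im η > 0 the integrand in t is a constant times `kernNum
/ kernDen` times two theta functions, and its two families of poles lie above and below the real
axis. Instead of bending the contour around poles that cross it, a Bezout identity (`exists_bezout`)
splits the kernel, multiplied by finitely many factors in η, into two terms: one has lost its first
poles above the axis, the other its first poles below. Their contours move to heights ±Y, where the
integrals are holomorphic for Im η > −Y/2 (`exists_isLevel`). Dividing by the factors in η and
letting Y grow yields the continuation (`exists_isContinuation`). Symmetry and resonance are proved
for Im η > 0 and carried to all regular η by the identity theorem (`exists_isKernel`). -/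

noncomputable section

namespace HypTheta

open Complex MeasureTheory Topology

/-! ### Products of factors `1 - exp (2 π i (w + c i))` -/

/-- `qexp x = exp (2 π i x)`. -/
def qexp (x : ℂ) : ℂ := exp (2 * Real.pi * I * x)

lemma qexp_add (x y : ℂ) : qexp (x + y) = qexp x * qexp y := by
  rw [qexp, mul_add, exp_add]; rfl

lemma qexp_neg (x : ℂ) : qexp (-x) = (qexp x)⁻¹ := by
  rw [qexp, mul_neg, exp_neg]; rfl

lemma qexp_ne_zero (x : ℂ) : qexp x ≠ 0 := exp_ne_zero _

lemma qexp_eq_one_iff {x : ℂ} : qexp x = 1 ↔ ∃ n : ℤ, x = n := by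
  have h0 : (2 * Real.pi * I : ℂ) ≠ 0 := by simp [Real.pi_ne_zero]
  rw [qexp, exp_eq_one_iff]
  refine exists_congr fun n => ⟨fun h => ?_, fun h => by rw [h]; ring⟩
  exact mul_left_cancel₀ h0 (by rw [h]; ring)

@[simp] lemma qexp_int (n : ℤ) : qexp n = 1 := qexp_eq_one_iff.2 ⟨n, rfl⟩

@[simp] lemma qexp_zero : qexp 0 = 1 := by simp [qexp]

@[simp] lemma qexp_one : qexp 1 = 1 := by simpa using qexp_int 1

lemma norm_qexp (x : ℂ) : ‖qexp x‖ = Real.exp (-(2 * Real.pi * x.im)) := by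
  rw [qexp, norm_exp]
  congr 1
  simp

lemma qexp_ne_one_of_im_pos {x : ℂ} (hx : 0 < x.im) : qexp x ≠ 1 := by
  intro h
  obtain ⟨n, rfl⟩ := qexp_eq_one_iff.1 h
  simp at hx

lemma differentiable_qexp : Differentiable ℂ qexp := by
  unfold qexp; fun_prop

section eprod

variable {ι : Type*}

/-- The product `∏ i, (1 - exp (2 π i (w + c i)))`. -/
def eprod (c : ι → ℂ) (w : ℂ) : ℂ := ∏' i, (1 - qexp (w + c i))

lemma summable_norm_qexp_add {c : ι → ℂ} (hc : Summable fun i => ‖qexp (c i)‖) (w : ℂ) :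
    Summable fun i => ‖-qexp (w + c i)‖ := by
  simpa [qexp_add] using hc.mul_left ‖qexp w‖

lemma multipliable_eprod {c : ι → ℂ} (hc : Summable fun i => ‖qexp (c i)‖) (w : ℂ) :
    Multipliable fun i => 1 - qexp (w + c i) := by
  simpa [sub_eq_add_neg] using multipliable_one_add_of_summable (summable_norm_qexp_add hc w)

lemma hasProd_eprod {c : ι → ℂ} (hc : Summable fun i => ‖qexp (c i)‖) (w : ℂ) :
    HasProd (fun i => 1 - qexp (w + c i)) (eprod c w) :=
  (multipliable_eprod hc w).hasProd

lemma differentiable_eprod {c : ι → ℂ} (hc : Summable fun i => ‖qexp (c i)‖) :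
    Differentiable ℂ (eprod c) := by
  intro w₀
  set K : Set ℂ := Metric.ball w₀ 1
  obtain ⟨B, hB⟩ := (isCompact_closedBall w₀ 1).exists_bound_of_continuousOn
    differentiable_qexp.continuous.continuousOn
  have h := Summable.hasProdLocallyUniformlyOn_one_add (f := fun i w => -qexp (w + c i))
    (K := K) Metric.isOpen_ball (hc.mul_left B) (.of_forall fun i w hw => by
      rw [norm_neg, qexp_add, norm_mul]
      exact mul_le_mul_of_nonneg_right (hB w (Metric.ball_subset_closedBall hw)) (norm_nonneg _))
    (fun i => (differentiable_qexp.continuous.comp (by fun_prop)).neg.continuousOn)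
  have hd := h.differentiableOn (.of_forall fun s => by
    simpa [Finset.prod_fn] using DifferentiableOn.finsetProd (fun i _ =>
      ((differentiable_const 1).add
        (differentiable_qexp.comp (differentiable_id.add_const (c i))).neg).differentiableOn))
    Metric.isOpen_ball
  refine (hd.congr fun w _ => ?_).differentiableAt (Metric.ball_mem_nhds w₀ one_pos)
  simp [eprod, sub_eq_add_neg]

lemma eprod_ne_zero {c : ι → ℂ} (hc : Summable fun i => ‖qexp (c i)‖) {w : ℂ}
    (h : ∀ i, qexp (w + c i) ≠ 1) : eprod c w ≠ 0 := by
  have := tprod_one_add_ne_zero_of_summable (f := fun i => -qexp (w + c i))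
    (fun i hi => h i (by linear_combination -hi)) (summable_norm_qexp_add hc w)
  simpa [eprod, sub_eq_add_neg] using this

lemma eprod_add_int (c : ι → ℂ) (w : ℂ) (n : ℤ) : eprod c (w + n) = eprod c w := by
  simp only [eprod, qexp_add, qexp_int, mul_one]

/-- Splitting off finitely many factors removes the zeros nearest to the real axis: the remaining
tail has no zeros until further down in the lower half plane, see `wtail_ne_zero`. -/
lemma eprod_eq_prod_mul {c : ι → ℂ} (hc : Summable fun i => ‖qexp (c i)‖) (s : Finset ι)
    (w : ℂ) : eprod c w =
      (∏ i ∈ s, (1 - qexp (w + c i))) * eprod (fun i : {i // i ∉ s} => c i) w := by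
  have h1 : Multipliable ((fun i => 1 - qexp (w + c i)) ∘ (fun x : (s : Set ι) => (x : ι))) :=
    (hasProd_fintype _).multipliable
  have h2 : Multipliable ((fun i => 1 - qexp (w + c i)) ∘ (fun x : ((s : Set ι)ᶜ : Set ι) => (x : ι))) :=
    multipliable_eprod (c := fun i : ((s : Set ι)ᶜ : Set ι) => c i)
      (hc.comp_injective Subtype.val_injective) w
  have := Multipliable.tprod_mul_tprod_compl (f := fun i => 1 - qexp (w + c i)) h1 h2
  rw [eprod, ← this]
  congr 1
  exact Finset.tprod_subtype s (fun i => 1 - qexp (w + c i))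

end eprod

/-! ### Single and double products -/

/-- `xprod τ w = ∏_{j ≥ 0} (1 - exp (2 π i (w + j τ)))`. -/
def xprod (τ w : ℂ) : ℂ := eprod (fun j : ℕ => (j : ℂ) * τ) w

/-- `wprod τ σ w = ∏_{j, k ≥ 0} (1 - exp (2 π i (w + j τ + k σ)))`. -/
def wprod (τ σ w : ℂ) : ℂ := eprod (fun p : ℕ × ℕ => (p.1 : ℂ) * τ + p.2 * σ) w

section products

variable {τ σ : ℂ}

lemma summable_xprod (hτ : 0 < τ.im) : Summable fun j : ℕ => ‖qexp ((j : ℂ) * τ)‖ := by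
  have h : ∀ j : ℕ, ‖qexp ((j : ℂ) * τ)‖ = Real.exp (-(2 * Real.pi * τ.im)) ^ j := by
    intro j
    rw [norm_qexp, ← Real.exp_nat_mul]
    congr 1
    simp
    ring
  simp_rw [h]
  refine summable_geometric_of_lt_one (Real.exp_pos _).le (Real.exp_lt_one_iff.mpr ?_)
  have := Real.pi_pos
  have : 0 < 2 * Real.pi * τ.im := by positivity
  linarith

lemma summable_wprod (hτ : 0 < τ.im) (hσ : 0 < σ.im) :
    Summable fun p : ℕ × ℕ => ‖qexp ((p.1 : ℂ) * τ + p.2 * σ)‖ := by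
  simp_rw [qexp_add, norm_mul]
  exact (summable_xprod hτ).mul_of_nonneg (summable_xprod hσ)
    (fun _ => norm_nonneg _) (fun _ => norm_nonneg _)

lemma differentiable_xprod (hτ : 0 < τ.im) : Differentiable ℂ (xprod τ) :=
  differentiable_eprod (summable_xprod hτ)

lemma differentiable_wprod (hτ : 0 < τ.im) (hσ : 0 < σ.im) : Differentiable ℂ (wprod τ σ) :=
  differentiable_eprod (summable_wprod hτ hσ)

lemma xprod_add_int (w : ℂ) (n : ℤ) : xprod τ (w + n) = xprod τ w := eprod_add_int _ _ _

lemma wprod_add_int (w : ℂ) (n : ℤ) : wprod τ σ (w + n) = wprod τ σ w := eprod_add_int _ _ _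

lemma tprod_eq_zero_mul_of_succ {f g : ℕ → ℂ} (h : ∀ j, f (j + 1) = g j) (hg : Multipliable g) :
    ∏' j, f j = f 0 * ∏' j, g j := by
  have hm : Multipliable fun j => f (j + 1) := by simpa only [h] using hg
  simpa only [h] using tprod_eq_zero_mul' hm

lemma xprod_eq (hτ : 0 < τ.im) (w : ℂ) : xprod τ w = (1 - qexp w) * xprod τ (w + τ) := by
  have := tprod_eq_zero_mul_of_succ (f := fun j : ℕ => 1 - qexp (w + (j : ℂ) * τ))
    (fun j => by rw [Nat.cast_succ, add_one_mul, add_comm _ τ, ← add_assoc])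
    (multipliable_eprod (summable_xprod hτ) (w + τ))
  simpa [xprod, eprod] using this

lemma wprod_swap (τ σ w : ℂ) : wprod τ σ w = wprod σ τ w := by
  rw [wprod, wprod, eprod, eprod, ← (Equiv.prodComm ℕ ℕ).tprod_eq]
  simp [add_comm]

lemma wprod_eq_tprod_xprod (hτ : 0 < τ.im) (hσ : 0 < σ.im) (w : ℂ) :
    Multipliable (fun k : ℕ => xprod τ (w + k * σ)) ∧
      wprod τ σ w = ∏' k : ℕ, xprod τ (w + k * σ) := by
  have h := hasProd_eprod (summable_wprod hσ hτ) w
  have hp : HasProd (fun k : ℕ => xprod τ (w + k * σ)) (wprod σ τ w) := by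
    refine h.prod_fiberwise fun k => ?_
    have := hasProd_eprod (summable_xprod hτ) (w + k * σ)
    refine this.congr_fun fun j => ?_
    simp only [add_assoc]
  exact ⟨hp.multipliable, by rw [wprod_swap, hp.tprod_eq]⟩

/-- The factors with k = 0 form a single product in τ. This equation and its mirror image are what
allow theta functions to cancel against ratios of double products. -/
lemma wprod_eq_right (hτ : 0 < τ.im) (hσ : 0 < σ.im) (w : ℂ) :
    wprod τ σ w = xprod τ w * wprod τ σ (w + σ) := by
  obtain ⟨hm, he⟩ := wprod_eq_tprod_xprod hτ hσ (w + σ)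
  have := tprod_eq_zero_mul_of_succ (f := fun k : ℕ => xprod τ (w + (k : ℂ) * σ))
    (fun k => by rw [Nat.cast_succ, add_one_mul, add_comm _ σ, ← add_assoc]) hm
  rw [(wprod_eq_tprod_xprod hτ hσ w).2, this, he]
  simp

lemma wprod_eq_left (hτ : 0 < τ.im) (hσ : 0 < σ.im) (w : ℂ) :
    wprod τ σ w = xprod σ w * wprod τ σ (w + τ) := by
  rw [wprod_swap, wprod_eq_right hσ hτ, wprod_swap]

lemma xprod_ne_zero (hτ : 0 < τ.im) {w : ℂ} (h : ∀ (j : ℕ) (n : ℤ), w + j * τ ≠ n) :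
    xprod τ w ≠ 0 :=
  eprod_ne_zero (summable_xprod hτ) fun j hj => by
    obtain ⟨n, hn⟩ := qexp_eq_one_iff.1 hj
    exact h j n hn

lemma xprod_ne_zero_of_im_pos (hτ : 0 < τ.im) {w : ℂ} (hw : 0 < w.im) : xprod τ w ≠ 0 :=
  eprod_ne_zero (summable_xprod hτ) fun j => qexp_ne_one_of_im_pos (by
    have : 0 ≤ (j : ℝ) * τ.im := by positivity
    simp; linarith)

lemma wprod_ne_zero_of_im_pos (hτ : 0 < τ.im) (hσ : 0 < σ.im) {w : ℂ} (hw : 0 < w.im) :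
    wprod τ σ w ≠ 0 :=
  eprod_ne_zero (summable_wprod hτ hσ) fun p => qexp_ne_one_of_im_pos (by
    have : 0 ≤ (p.1 : ℝ) * τ.im := by positivity
    have : 0 ≤ (p.2 : ℝ) * σ.im := by positivity
    simp; linarith)

end products

/-! ### Holomorphic dependence of integrals on parameters -/

/-- A local bound on `F` alone suffices: Cauchy's estimate on circles of radius r/4 turns it into an
integrable bound on the derivative, as needed for differentiation under the integral. -/
lemma differentiableOn_integral {α : Type*} [MeasurableSpace α] {μ : Measure α}
    {F : ℂ → α → ℂ} {s : Set ℂ} (hs : IsOpen s)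
    (hmeas : ∀ z ∈ s, AEStronglyMeasurable (F z) μ)
    (hdiff : ∀ᵐ a ∂μ, DifferentiableOn ℂ (fun z => F z a) s)
    (hbound : ∀ z₀ ∈ s, ∃ r > 0, ∃ g : α → ℝ, Integrable g μ ∧
      ∀ᵐ a ∂μ, ∀ z ∈ Metric.ball z₀ r, ‖F z a‖ ≤ g a) :
    DifferentiableOn ℂ (fun z => ∫ a, F z a ∂μ) s := by
  intro z₀ hz₀
  obtain ⟨r₁, hr₁, g, hg, hFg⟩ := hbound z₀ hz₀
  obtain ⟨r₂, hr₂, hball⟩ := Metric.isOpen_iff.1 hs z₀ hz₀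
  set r := min r₁ r₂ with hr
  have hr0 : 0 < r := lt_min hr₁ hr₂
  have hsub : Metric.ball z₀ r ⊆ s := (Metric.ball_subset_ball (min_le_right _ _)).trans hball
  have hderiv : ∀ᵐ a ∂μ, ∀ z ∈ Metric.ball z₀ (r / 2),
      HasDerivAt (fun z => F z a) (deriv (fun z => F z a) z) z := by
    filter_upwards [hdiff] with a ha z hz
    exact (ha.differentiableAt (hs.mem_nhds (hsub
      (Metric.ball_subset_ball (by linarith) hz)))).hasDerivAt
  have hle : ∀ᵐ a ∂μ, ∀ z ∈ Metric.ball z₀ (r / 2),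
      ‖deriv (fun z => F z a) z‖ ≤ g a / (r / 4) := by
    filter_upwards [hdiff, hFg] with a ha hb z hz
    have hsub' : Metric.closedBall z (r / 4) ⊆ Metric.ball z₀ r := by
      intro w hw
      rw [Metric.mem_ball] at hz ⊢
      rw [Metric.mem_closedBall] at hw
      linarith [dist_triangle w z z₀]
    refine norm_deriv_le_of_forall_mem_sphere_norm_le (by positivity) ?_ fun w hw => ?_
    · refine DifferentiableOn.diffContOnCl ?_
      rw [closure_ball _ (by positivity)]
      exact ha.mono (hsub'.trans hsub)
    · exact hb w (Metric.ball_subset_ball (min_le_left _ _)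
        (hsub' (Metric.sphere_subset_closedBall hw)))
  have hmeas' : AEStronglyMeasurable (fun a => deriv (fun z => F z a) z₀) μ := by
    -- The derivative is measurable in `a` as a pointwise limit of difference quotients along this
    -- null sequence.
    set y : ℕ → ℂ := fun n => ((r / 2 / (n + 1) : ℝ) : ℂ) with hy
    have hy0 : ∀ n, y n ≠ 0 := fun n => by
      exact ofReal_ne_zero.2 (by positivity)
    have hylim : Filter.Tendsto y Filter.atTop (𝓝[≠] 0) := by
      refine tendsto_nhdsWithin_iff.2 ⟨?_, .of_forall hy0⟩
      have : Filter.Tendsto (fun n : ℕ => r / 2 / ((n : ℝ) + 1)) Filter.atTop (𝓝 0) :=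
        tendsto_const_nhds.div_atTop (Filter.tendsto_atTop_add_const_right _ _
          tendsto_natCast_atTop_atTop)
      have h := (continuous_ofReal.tendsto 0).comp this
      rwa [ofReal_zero] at h
    have hys : ∀ n, z₀ + y n ∈ s := fun n => hsub (by
      rw [Metric.mem_ball, dist_eq_norm, add_sub_cancel_left, hy]
      simp only [norm_real, Real.norm_eq_abs]
      rw [abs_of_pos (by positivity)]
      have : r / 2 / (n + 1 : ℝ) ≤ r / 2 := div_le_self (by positivity) (by linarith [n.cast_nonneg (α := ℝ)])
      linarith)
    refine aestronglyMeasurable_of_tendsto_ae Filter.atTop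
      (f := fun n a => (y n)⁻¹ • (F (z₀ + y n) a - F z₀ a))
      (fun n => ((hmeas _ (hys n)).sub (hmeas _ hz₀)).const_smul (y n)⁻¹) ?_
    filter_upwards [hderiv] with a ha
    exact (ha z₀ (Metric.mem_ball_self (by positivity))).tendsto_slope_zero.comp hylim
  have hint : Integrable (F z₀) μ := by
    refine hg.mono' (hmeas _ hz₀) ?_
    filter_upwards [hFg] with a ha using ha z₀ (Metric.mem_ball_self hr₁)
  have := hasDerivAt_integral_of_dominated_loc_of_deriv_le
    (Metric.ball_mem_nhds z₀ (by positivity : 0 < r / 2))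
    (F := F) (F' := fun z a => deriv (fun z => F z a) z) (bound := fun a => g a / (r / 4))
    (Filter.eventually_of_mem (hs.mem_nhds hz₀) hmeas) hint hmeas' hle (hg.div_const _) hderiv
  exact this.2.differentiableAt.differentiableWithinAt

lemma differentiableOn_intervalIntegral {F : ℂ → ℝ → ℂ} {s : Set ℂ} (hs : IsOpen s)
    (hc : ContinuousOn (Function.uncurry F) (s ×ˢ Set.Icc 0 1))
    (hdiff : ∀ t ∈ Set.Icc (0 : ℝ) 1, DifferentiableOn ℂ (fun z => F z t) s) :
    DifferentiableOn ℂ (fun z => ∫ t in (0 : ℝ)..1, F z t) s := by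
  simp_rw [intervalIntegral.integral_of_le zero_le_one]
  have hIoc : ∀ z ∈ s, ContinuousOn (F z) (Set.Icc 0 1) := fun z hz =>
    hc.comp (by fun_prop : ContinuousOn (fun t : ℝ => (z, t)) (Set.Icc 0 1)) fun t ht => ⟨hz, ht⟩
  refine differentiableOn_integral hs (fun z hz => ?_) ?_ fun z₀ hz₀ => ?_
  · exact ((hIoc z hz).mono Set.Ioc_subset_Icc_self).aestronglyMeasurable measurableSet_Ioc
  · filter_upwards [ae_restrict_mem measurableSet_Ioc] with t ht
    exact hdiff t (Set.Ioc_subset_Icc_self ht)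
  · obtain ⟨r, hr, hball⟩ := Metric.nhds_basis_closedBall.mem_iff.1 (hs.mem_nhds hz₀)
    obtain ⟨B, hB⟩ := ((isCompact_closedBall z₀ r).prod isCompact_Icc).exists_bound_of_continuousOn
      (hc.mono (Set.prod_mono hball le_rfl))
    refine ⟨r, hr, fun _ => B, integrable_const B, ?_⟩
    filter_upwards [ae_restrict_mem measurableSet_Ioc] with t ht z hz
    exact hB (z, t) ⟨Metric.ball_subset_closedBall hz, Set.Ioc_subset_Icc_self ht⟩

/-! ### Moving contours -/

/-- Invariance under real translations kills the derivative along the real direction, which for a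
holomorphic function is the whole derivative. Applied to integrals over horizontal lines as
functions of the offset, this takes the place of Cauchy's theorem on rectangles. -/
lemma eq_of_real_translation_invariant {Ψ : ℂ → ℂ} {s : Set ℂ} (hs : IsOpen s)
    (hs' : IsPreconnected s) (hΨ : DifferentiableOn ℂ Ψ s)
    (h : ∀ w ∈ s, ∀ a : ℝ, Ψ (w + a) = Ψ w) {v w : ℂ} (hv : v ∈ s) (hw : w ∈ s) : Ψ v = Ψ w := by
  refine hs.is_const_of_deriv_eq_zero hs' hΨ (fun z hz => ?_) hv hw
  have h1 : HasDerivAt Ψ (deriv Ψ z) (z + (0 : ℝ)) := by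
    simpa using (hΨ.differentiableAt (hs.mem_nhds hz)).hasDerivAt
  have h2 : HasDerivAt (fun a : ℝ => Ψ (z + a)) (deriv Ψ z * 1) 0 :=
    h1.comp (0 : ℝ) ((ofRealCLM.hasDerivAt (x := (0 : ℝ))).const_add z)
  simp_rw [h z hz] at h2
  simpa using h2.unique (hasDerivAt_const (0 : ℝ) (Ψ z))

/-- The open strip `a < Im w < b`. -/
def strip (a b : ℝ) : Set ℂ := {w | a < w.im ∧ w.im < b}

lemma isOpen_strip (a b : ℝ) : IsOpen (strip a b) :=
  (isOpen_lt continuous_const continuous_im).inter (isOpen_lt continuous_im continuous_const)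

lemma isPreconnected_strip (a b : ℝ) : IsPreconnected (strip a b) :=
  ((convex_halfSpace_im_gt a).inter (convex_halfSpace_im_lt b)).isPreconnected

lemma integral_periodic_eq_of_mem_strip {g : ℂ → ℂ} {a b : ℝ}
    (hg : DifferentiableOn ℂ g (strip a b)) (hper : ∀ z, g (z + 1) = g z) {v w : ℂ}
    (hv : v ∈ strip a b) (hw : w ∈ strip a b) :
    ∫ t in (0 : ℝ)..1, g (t + v) = ∫ t in (0 : ℝ)..1, g (t + w) := by
  have hmem : ∀ z ∈ strip a b, ∀ t : ℝ, (t : ℂ) + z ∈ strip a b := fun z hz t => by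
    simpa [strip] using hz
  refine eq_of_real_translation_invariant (Ψ := fun z => ∫ t in (0 : ℝ)..1, g (t + z))
    (isOpen_strip a b) (isPreconnected_strip a b) ?_ (fun z _ c => ?_) hv hw
  · refine differentiableOn_intervalIntegral (isOpen_strip a b) ?_ fun t _ => ?_
    · exact hg.continuousOn.comp
        (by fun_prop : Continuous fun p : ℂ × ℝ => (p.2 : ℂ) + p.1).continuousOn
        fun p hp => hmem _ hp.1 _
    · exact hg.comp (by fun_prop) fun z hz => hmem z hz t
  · have hp : Function.Periodic (fun t : ℝ => g (t + z)) 1 := fun t => by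
      change g (((t + 1 : ℝ) : ℂ) + z) = g (t + z)
      rw [← hper (t + z)]
      congr 1
      push_cast
      ring
    have h1 : ∀ t : ℝ, g (t + (z + c)) = (fun t : ℝ => g (t + z)) (t + c) := fun t => by
      simp only
      congr 1
      push_cast
      ring
    simp_rw [h1]
    rw [intervalIntegral.integral_comp_add_right (fun t : ℝ => g (t + z)), zero_add, add_comm 1 c,
      hp.intervalIntegral_add_eq c 0, zero_add]

lemma integral_periodic_neg {g : ℂ → ℂ} (hper : ∀ z, g (z + 1) = g z) :
    ∫ t in (0 : ℝ)..1, g (-t) = ∫ t in (0 : ℝ)..1, g t := by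
  have hp : Function.Periodic (fun t : ℝ => g t) 1 := fun t => by
    change g ((t + 1 : ℝ) : ℂ) = g t
    rw [← hper t]
    push_cast
    rfl
  have := intervalIntegral.integral_comp_neg (a := 0) (b := 1) (fun t : ℝ => g t)
  simp only [ofReal_neg] at this
  rw [this, neg_zero]
  have h2 := hp.intervalIntegral_add_eq (-1) 0
  simpa using h2

lemma integral_line_eq {g : ℂ → ℂ} (hg : Differentiable ℂ g)
    (hb : ∀ w : ℂ, ∃ r > 0, ∃ b : ℝ → ℝ, Integrable b ∧
      ∀ z ∈ Metric.ball w r, ∀ x : ℝ, ‖g (x + z)‖ ≤ b x) (w : ℂ) :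
    ∫ x : ℝ, g (x + w) = ∫ x : ℝ, g x := by
  have := eq_of_real_translation_invariant (Ψ := fun z => ∫ x : ℝ, g (x + z)) isOpen_univ
    isPreconnected_univ ?_ (fun z _ c => ?_) (Set.mem_univ w) (Set.mem_univ 0)
  · simpa using this
  · refine differentiableOn_integral isOpen_univ (fun z _ => ?_) (.of_forall fun x => ?_)
      fun z₀ _ => ?_
    · exact (hg.continuous.comp (by fun_prop)).aestronglyMeasurable
    · exact (hg.comp (differentiable_id.const_add (x : ℂ))).differentiableOn
    · obtain ⟨r, hr, b, hbi, h⟩ := hb z₀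
      exact ⟨r, hr, b, hbi, .of_forall fun x z hz => h z hz x⟩
  · have h1 : ∀ x : ℝ, g (x + (z + c)) = (fun x : ℝ => g (x + z)) (x + c) := fun x => by
      simp only
      congr 1
      push_cast
      ring
    simp_rw [h1]
    exact integral_add_right_eq_self (fun x : ℝ => g (x + z)) c

/-! ### Division of entire functions -/

/-- The quotient `f / g`, with its removable singularities at simple zeros of `g` removed. -/
def entireQuot (f g : ℂ → ℂ) (z : ℂ) : ℂ := if g z = 0 then deriv f z / deriv g z else f z / g z

section entireQuot

variable {f g : ℂ → ℂ}

lemma entireQuot_mul (hfg : ∀ z, g z = 0 → f z = 0) (z : ℂ) : entireQuot f g z * g z = f z := by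
  rw [entireQuot]
  split_ifs with h
  · rw [h, mul_zero, hfg z h]
  · exact div_mul_cancel₀ _ h

/-- At a simple zero z₀ of `g` both functions are z − z₀ times their `dslope`, and the `dslope` of
`g` is nonzero at z₀. -/
lemma differentiable_entireQuot (hf : Differentiable ℂ f) (hg : Differentiable ℂ g)
    (hfg : ∀ z, g z = 0 → f z = 0) (hg' : ∀ z, g z = 0 → deriv g z ≠ 0) :
    Differentiable ℂ (entireQuot f g) := by
  intro z₀
  by_cases h : g z₀ = 0
  · have hdf : Differentiable ℂ (dslope f z₀) := by
      rw [← differentiableOn_univ] at hf ⊢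
      exact (differentiableOn_dslope Filter.univ_mem).2 hf
    have hdg : Differentiable ℂ (dslope g z₀) := by
      rw [← differentiableOn_univ] at hg ⊢
      exact (differentiableOn_dslope Filter.univ_mem).2 hg
    have hne : dslope g z₀ z₀ ≠ 0 := by
      rw [dslope_same]
      exact hg' z₀ h
    refine ((hdf z₀).div (hdg z₀) hne).congr_of_eventuallyEq ?_
    filter_upwards [hdg.continuous.continuousAt.eventually_ne hne] with z hz
    by_cases hzz : z = z₀
    · subst hzz
      simp [entireQuot, h]
    · have hsub : z - z₀ ≠ 0 := sub_ne_zero.2 hzz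
      have h1 : g z = (z - z₀) * dslope g z₀ z := by
        simpa [h] using (sub_smul_dslope g z₀ z).symm
      have h2 : f z = (z - z₀) * dslope f z₀ z := by
        simpa [hfg z₀ h] using (sub_smul_dslope f z₀ z).symm
      have h3 : g z ≠ 0 := by rw [h1]; exact mul_ne_zero hsub hz
      rw [entireQuot, if_neg h3, h1, h2, Pi.div_apply]
      field_simp
  · refine ((hf z₀).div (hg z₀) h).congr_of_eventuallyEq ?_
    filter_upwards [hg.continuous.continuousAt.eventually_ne h] with z hz
    rw [entireQuot, if_neg hz, Pi.div_apply]

lemma entireQuot_eq_of_ne {z : ℂ} (h : g z ≠ 0) : entireQuot f g z = f z / g z := if_neg h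

end entireQuot

lemma dense_ne_zero_of_countable {g : ℂ → ℂ} (h : {z | g z = 0}.Countable) :
    Dense {z | g z ≠ 0} := by
  have := h.dense_compl ℝ
  exact this

/-! ### Growth of theta functions -/

/-- The function |h(z)| exp(−πk (Im z)²/(2 Im τ)) is invariant under 2ℤ + 2ℤτ, so its bound on a
compact set containing representatives of all classes is global. -/
lemma exists_bound_of_quasiperiodic {h : ℂ → ℂ} (hc : Continuous h) {τ : ℂ} (hτ : 0 < τ.im)
    (k : ℤ) (hh : ∀ (r s : ℤ) (z : ℂ), h (z + 2 * r + 2 * s * τ) =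
      exp (-(2 * Real.pi * I * k * ((s : ℂ) ^ 2 * τ + s * z))) * h z) :
    ∃ C : ℝ, 0 ≤ C ∧ ∀ z, ‖h z‖ ≤ C * Real.exp (Real.pi * k * z.im ^ 2 / (2 * τ.im)) := by
  have hK : IsCompact (Set.Icc (0 : ℝ) 2 ×ℂ Set.Icc 0 (2 * τ.im)) :=
    isCompact_Icc.reProdIm isCompact_Icc
  obtain ⟨C, hC⟩ := hK.exists_bound_of_continuousOn
    (f := fun z => h z * (Real.exp (-(Real.pi * k * z.im ^ 2 / (2 * τ.im))) : ℝ))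
    (by fun_prop)
  refine ⟨|C|, abs_nonneg _, fun z => ?_⟩
  set s := ⌊z.im / (2 * τ.im)⌋ with hs
  set r := ⌊(z - 2 * s * τ).re / 2⌋ with hr
  set w := z - 2 * s * τ - 2 * r with hw
  have hz : z = w + 2 * r + 2 * s * τ := by rw [hw]; ring
  have hwim : w.im = z.im - 2 * s * τ.im := by simp [hw]
  have hwre : w.re = (z - 2 * s * τ).re - 2 * r := by simp [hw]
  have h1 := Int.floor_le (z.im / (2 * τ.im))
  have h2 := Int.lt_floor_add_one (z.im / (2 * τ.im))
  have h3 := Int.floor_le ((z - 2 * s * τ).re / 2)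
  have h4 := Int.lt_floor_add_one ((z - 2 * s * τ).re / 2)
  rw [← hs] at h1 h2
  rw [← hr] at h3 h4
  rw [le_div_iff₀ (by positivity)] at h1
  rw [div_lt_iff₀ (by positivity)] at h2
  have hwK : w ∈ Set.Icc (0 : ℝ) 2 ×ℂ Set.Icc 0 (2 * τ.im) := by
    refine ⟨⟨?_, ?_⟩, ⟨?_, ?_⟩⟩
    · rw [hwre]; linarith
    · rw [hwre]; linarith
    · rw [hwim]; linarith
    · rw [hwim]; linarith
  have hb := (hC w hwK).trans (le_abs_self C)
  rw [norm_mul, norm_real, Real.norm_eq_abs, Real.abs_exp] at hb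
  have hb' : ‖h w‖ ≤ |C| * Real.exp (Real.pi * k * w.im ^ 2 / (2 * τ.im)) := by
    rwa [Real.exp_neg, ← div_eq_mul_inv, div_le_iff₀ (Real.exp_pos _)] at hb
  have hexp : (-(2 * Real.pi * I * k * ((s : ℂ) ^ 2 * τ + s * w))).re =
      2 * Real.pi * k * (s ^ 2 * τ.im + s * w.im) := by
    have : -(2 * Real.pi * I * k * ((s : ℂ) ^ 2 * τ + s * w)) =
        ((2 * Real.pi * k : ℝ) : ℂ) * (-I * (((s ^ 2 : ℝ) : ℂ) * τ + (s : ℝ) * w)) := by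
      push_cast; ring
    rw [this, re_ofReal_mul]
    simp only [neg_mul, neg_re, mul_re, I_re, I_im, add_im, im_ofReal_mul]
    ring
  have hfin : Real.exp (Real.pi * k * z.im ^ 2 / (2 * τ.im)) =
      Real.exp (2 * Real.pi * k * (s ^ 2 * τ.im + s * w.im)) *
        Real.exp (Real.pi * k * w.im ^ 2 / (2 * τ.im)) := by
    rw [← Real.exp_add]
    congr 1
    have : z.im = w.im + 2 * s * τ.im := by rw [hwim]; ring
    rw [this]
    field_simp
    ring
  rw [hfin, hz, hh, norm_mul, norm_exp, hexp]
  calc _ ≤ Real.exp (2 * Real.pi * k * (s ^ 2 * τ.im + s * w.im)) *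
        (|C| * Real.exp (Real.pi * k * w.im ^ 2 / (2 * τ.im))) := by gcongr
    _ = _ := by ring

/-! ### The first Jacobi theta function -/

lemma exp_pi_int_mul_two (n : ℤ) : exp (Real.pi * I * (2 * n)) = 1 := by
  rw [exp_eq_one_iff]
  exact ⟨n, by ring⟩

lemma theta_add (z τ : ℂ) (r s : ℤ) : theta (z + r + s * τ) τ =
    exp (Real.pi * I * (r - s - s ^ 2 * τ - 2 * s * z)) * theta z τ := by
  rw [theta, theta, mul_neg, ← tsum_mul_left, neg_inj]
  symm
  rw [← (Equiv.addRight s).tsum_eq]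
  refine tsum_congr fun n => ?_
  have : Real.pi * I * (((n : ℂ) + 1 / 2) ^ 2 * τ + (n + 1 / 2) * (2 * (z + r + s * τ) + 1)) =
      Real.pi * I * (2 * ((n * r : ℤ) : ℂ)) + (Real.pi * I * (r - s - s ^ 2 * τ - 2 * s * z) +
      Real.pi * I * (((n : ℂ) + s + 1 / 2) ^ 2 * τ + (n + s + 1 / 2) * (2 * z + 1))) := by
    push_cast
    ring
  rw [this, exp_add, exp_pi_int_mul_two, one_mul, exp_add]
  simp

lemma theta_neg (z τ : ℂ) : theta (-z) τ = -theta z τ := by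
  rw [theta, theta, neg_neg, ← tsum_neg, ← (Equiv.subLeft (-1 : ℤ)).tsum_eq]
  refine tsum_congr fun n => ?_
  have : Real.pi * I * ((((Equiv.subLeft (-1 : ℤ)) n : ℤ) + 1 / 2 : ℂ) ^ 2 * τ +
      (((Equiv.subLeft (-1 : ℤ)) n : ℤ) + 1 / 2) * (2 * -z + 1)) =
      Real.pi * I * (((n : ℂ) + 1 / 2) ^ 2 * τ + ((n : ℂ) + 1 / 2) * (2 * z + 1)) +
      Real.pi * I * (2 * ((-n : ℤ) : ℂ)) - Real.pi * I := by
    simp only [Equiv.subLeft_apply]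
    push_cast
    ring
  rw [this, exp_sub, exp_add, exp_pi_int_mul_two, exp_pi_mul_I, div_neg, div_one, mul_one, neg_neg]

lemma theta_zero (τ : ℂ) : theta 0 τ = 0 := by
  have := theta_neg 0 τ
  rw [neg_zero] at this
  exact self_eq_neg.1 this

lemma theta_add_one (z τ : ℂ) : theta (z + 1) τ = -theta z τ := by
  have := theta_add z τ 1 0
  simpa using this

lemma theta_eq_jacobiTheta₂ (z τ : ℂ) : theta z τ =
    -(exp (Real.pi * I * (τ / 4 + z + 1 / 2)) * jacobiTheta₂ (z + 1 / 2 + τ / 2) τ) := by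
  rw [theta, jacobiTheta₂, ← tsum_mul_left]
  congr 1
  refine tsum_congr fun n => ?_
  rw [jacobiTheta₂_term, ← exp_add]
  congr 1
  ring

lemma differentiable_theta {τ : ℂ} (hτ : 0 < τ.im) : Differentiable ℂ fun z => theta z τ := by
  simp_rw [theta_eq_jacobiTheta₂]
  refine (Differentiable.mul (by fun_prop) fun z => ?_).neg
  exact (differentiableAt_jacobiTheta₂_fst (z + 1 / 2 + τ / 2) hτ).comp z
    (by fun_prop : DifferentiableAt ℂ (fun z : ℂ => z + 1 / 2 + τ / 2) z)

lemma theta_mem_Theta {τ : ℂ} (hτ : 0 < τ.im) : (fun z => theta z τ) ∈ Theta 2 τ := by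
  refine ⟨differentiable_theta hτ, fun r s z => ?_⟩
  have := theta_add z τ (2 * r) (2 * s)
  push_cast at this
  simp only [this]
  congr 1
  have h2 : Real.pi * I * (2 * r - 2 * s - (2 * s) ^ 2 * τ - 2 * (2 * s) * z) =
      Real.pi * I * (2 * ((r - s : ℤ) : ℂ)) +
        -(2 * Real.pi * I * (2 : ℤ) * ((s : ℂ) ^ 2 * τ + s * z)) := by
    push_cast
    ring
  rw [h2, exp_add, exp_pi_int_mul_two, one_mul]

/-- `exp (-π i z) ∏_{j ≥ 0} (1 - exp (2 π i (z + j τ))) (1 - exp (2 π i (-z + (j + 1) τ)))`. -/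
def thetaProd (τ z : ℂ) : ℂ := exp (-(Real.pi * I * z)) * (xprod τ z * xprod τ (τ - z))

section thetaProd

variable {τ : ℂ}

lemma differentiable_thetaProd (hτ : 0 < τ.im) : Differentiable ℂ (thetaProd τ) := by
  have := differentiable_xprod hτ
  unfold thetaProd
  fun_prop

lemma thetaProd_eq (hτ : 0 < τ.im) (z : ℂ) : thetaProd τ z =
    (1 - qexp z) * (exp (-(Real.pi * I * z)) * (xprod τ (z + τ) * xprod τ (τ - z))) := by
  rw [thetaProd, xprod_eq hτ z]
  ring

lemma thetaProd_add_int (z : ℂ) (r : ℤ) :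
    thetaProd τ (z + r) = exp (Real.pi * I * r) * thetaProd τ z := by
  have h : τ - (z + r) = τ - z + ((-r : ℤ) : ℂ) := by push_cast; ring
  have h2 : exp (-(Real.pi * I * (z + r))) =
      exp (Real.pi * I * r) * exp (-(Real.pi * I * z)) := by
    have : -(Real.pi * I * (z + r)) = Real.pi * I * r + -(Real.pi * I * z) +
        Real.pi * I * (2 * ((-r : ℤ) : ℂ)) := by push_cast; ring
    rw [this, exp_add, exp_add, exp_pi_int_mul_two, mul_one]
  rw [thetaProd, thetaProd, xprod_add_int, h, xprod_add_int, h2]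
  ring

lemma thetaProd_add_self (hτ : 0 < τ.im) (z : ℂ) :
    thetaProd τ (z + τ) = exp (Real.pi * I * (-1 - τ - 2 * z)) * thetaProd τ z := by
  have h1 : exp (Real.pi * I * (-1 - τ - 2 * z)) = -(exp (-(Real.pi * I * τ)) * (qexp z)⁻¹) := by
    have : Real.pi * I * (-1 - τ - 2 * z) =
        -(Real.pi * I * τ) + -(2 * Real.pi * I * z) - Real.pi * I := by ring
    rw [this, exp_sub, exp_add, exp_pi_mul_I, ← qexp_neg, qexp, mul_neg, div_neg, div_one]
  have h2 : exp (-(Real.pi * I * (z + τ))) =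
      exp (-(Real.pi * I * z)) * exp (-(Real.pi * I * τ)) := by
    rw [← exp_add]; ring_nf
  have h3 : xprod τ (τ - (z + τ)) = (1 - (qexp z)⁻¹) * xprod τ (τ - z) := by
    rw [show τ - (z + τ) = -z by ring, xprod_eq hτ, qexp_neg, neg_add_eq_sub]
  rw [thetaProd, h3, h2, thetaProd_eq hτ, h1]
  have := qexp_ne_zero z
  field_simp
  ring

lemma thetaProd_add (hτ : 0 < τ.im) (z : ℂ) (r s : ℤ) : thetaProd τ (z + r + s * τ) =
    exp (Real.pi * I * (r - s - s ^ 2 * τ - 2 * s * z)) * thetaProd τ z := by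
  have key : ∀ s : ℤ, ∀ z, thetaProd τ (z + s * τ) =
      exp (Real.pi * I * (-s - s ^ 2 * τ - 2 * s * z)) * thetaProd τ z := by
    intro s
    induction s using Int.induction_on with
    | zero => simp
    | succ n ih =>
      intro z
      have h : z + ((n + 1 : ℤ) : ℂ) * τ = z + (n : ℤ) * τ + τ := by push_cast; ring
      rw [h, thetaProd_add_self hτ, ih, ← mul_assoc, ← exp_add]
      congr 2
      push_cast
      ring
    | pred n ih =>
      intro z
      have h : z + ((-n : ℤ) : ℂ) * τ = z + ((-n - 1 : ℤ) : ℂ) * τ + τ := by push_cast; ring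
      have h2 := thetaProd_add_self hτ (z + ((-n - 1 : ℤ) : ℂ) * τ)
      rw [← h, ih] at h2
      refine mul_left_cancel₀ (exp_ne_zero _) (h2.symm.trans ?_)
      rw [← mul_assoc, ← exp_add]
      congr 2
      push_cast
      ring
  rw [key, thetaProd_add_int, ← mul_assoc, ← exp_add]
  have : Real.pi * I * (-s - s ^ 2 * τ - 2 * s * (z + r)) + Real.pi * I * r =
      Real.pi * I * (r - s - s ^ 2 * τ - 2 * s * z) + Real.pi * I * (2 * ((-(s * r) : ℤ) : ℂ)) := by
    push_cast
    ring
  rw [this, exp_add, exp_pi_int_mul_two, mul_one]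

lemma exists_of_thetaProd_eq_zero (hτ : 0 < τ.im) {z : ℂ} (h : thetaProd τ z = 0) :
    ∃ r s : ℤ, z = r + s * τ := by
  by_contra! hne
  refine mul_ne_zero (exp_ne_zero _) (mul_ne_zero (xprod_ne_zero hτ fun j n hj => ?_)
    (xprod_ne_zero hτ fun j n hj => ?_)) h
  · refine hne n (-j) ?_
    rw [← hj]; push_cast; ring
  · refine hne (-n) (j + 1) ?_
    push_cast
    rw [← hj]; ring

lemma thetaProd_zero (hτ : 0 < τ.im) : thetaProd τ 0 = 0 := by simp [thetaProd_eq hτ]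

lemma theta_lattice (τ : ℂ) (r s : ℤ) : theta (r + s * τ) τ = 0 := by
  have := theta_add 0 τ r s
  rwa [theta_zero, mul_zero, zero_add] at this

/-- At 0 the factor 1 − `qexp` vanishes to first order and the cofactor is nonzero;
quasi-periodicity carries this to every lattice point. -/
lemma deriv_thetaProd_ne_zero (hτ : 0 < τ.im) {z : ℂ} (h : thetaProd τ z = 0) :
    deriv (thetaProd τ) z ≠ 0 := by
  obtain ⟨r, s, rfl⟩ := exists_of_thetaProd_eq_zero hτ h
  set k : ℂ → ℂ := fun w => exp (-(Real.pi * I * w)) * (xprod τ (w + τ) * xprod τ (τ - w))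
  have hk : Differentiable ℂ k := by
    have := differentiable_xprod hτ
    fun_prop
  have hk0 : k 0 ≠ 0 := by
    simpa [k] using xprod_ne_zero_of_im_pos hτ hτ
  have hq : HasDerivAt (fun w => 1 - qexp w) (-(2 * Real.pi * I)) 0 := by
    have : HasDerivAt (fun w : ℂ => exp (2 * Real.pi * I * w))
        (exp (2 * Real.pi * I * 0) * (2 * Real.pi * I * 1)) 0 :=
      ((hasDerivAt_id (0 : ℂ)).const_mul (2 * Real.pi * I)).cexp
    simpa [qexp] using this.const_sub 1
  have h0 : HasDerivAt (thetaProd τ) (-(2 * Real.pi * I) * k 0) 0 := by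
    have := hq.mul (hk 0).hasDerivAt
    simp only [qexp_zero, sub_self, zero_mul, add_zero] at this
    exact this.congr_of_eventuallyEq (.of_forall fun w => thetaProd_eq hτ w)
  have hE : DifferentiableAt ℂ (fun w => exp (Real.pi * I * (r - s - s ^ 2 * τ - 2 * s * w))) 0 := by
    fun_prop
  have h1 := hE.hasDerivAt.mul h0
  simp only [thetaProd_zero hτ, mul_zero, zero_add] at h1
  have h2 : HasDerivAt (fun w => thetaProd τ (w + (r + s * τ)))
      (deriv (thetaProd τ) (r + s * τ)) 0 := by
    have := ((differentiable_thetaProd hτ) (0 + (r + s * τ))).hasDerivAt.comp_add_const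
      0 (r + s * τ)
    simpa using this
  have h3 := h2.unique (h1.congr_of_eventuallyEq (.of_forall fun w => by
    simp only [← add_assoc, thetaProd_add hτ, Pi.mul_apply]))
  rw [h3]
  have := Real.pi_ne_zero
  refine mul_ne_zero (exp_ne_zero _) (mul_ne_zero ?_ hk0)
  simp [this]

lemma countable_lattice (τ : ℂ) : {z : ℂ | ∃ r s : ℤ, z = r + s * τ}.Countable := by
  refine (Set.countable_range fun p : ℤ × ℤ => (p.1 : ℂ) + p.2 * τ).mono ?_
  rintro z ⟨r, s, rfl⟩
  exact ⟨(r, s), rfl⟩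

lemma countable_thetaProd_eq_zero (hτ : 0 < τ.im) : {z | thetaProd τ z = 0}.Countable :=
  (countable_lattice τ).mono fun _ h => exists_of_thetaProd_eq_zero hτ h

/-- The product expansion of `theta`, with an unspecified constant. -/
lemma exists_theta_eq_mul_thetaProd (hτ : 0 < τ.im) :
    ∃ c : ℂ, ∀ z, theta z τ = c * thetaProd τ z := by
  set f : ℂ → ℂ := fun z => theta z τ
  have hfg : ∀ z, thetaProd τ z = 0 → f z = 0 := fun z hz => by
    obtain ⟨r, s, rfl⟩ := exists_of_thetaProd_eq_zero hτ hz
    exact theta_lattice τ r s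
  set q := entireQuot f (thetaProd τ)
  have hq : Differentiable ℂ q := differentiable_entireQuot (differentiable_theta hτ)
    (differentiable_thetaProd hτ) hfg fun z hz => deriv_thetaProd_ne_zero hτ hz
  -- Periodicity is phrased as quasi-periodicity of level 0, so that the growth bound becomes a
  -- constant and Liouville's theorem applies.
  have hper : ∀ (r s : ℤ) (z : ℂ), q (z + 2 * r + 2 * s * τ) =
      exp (-(2 * Real.pi * I * (0 : ℤ) * ((s : ℂ) ^ 2 * τ + s * z))) * q z := by
    intro r s
    refine congr_fun (Continuous.ext_on
      (dense_ne_zero_of_countable (countable_thetaProd_eq_zero hτ))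
      (by have := hq.continuous; fun_prop) (by have := hq.continuous; fun_prop) fun z hz => ?_)
    have h1 := thetaProd_add hτ z (2 * r) (2 * s)
    have h2 := theta_add z τ (2 * r) (2 * s)
    push_cast at h1 h2
    have hz' : thetaProd τ (z + 2 * r + 2 * s * τ) ≠ 0 := by
      rw [h1]
      exact mul_ne_zero (exp_ne_zero _) hz
    simp only [q, f]
    rw [entireQuot_eq_of_ne hz', entireQuot_eq_of_ne hz, h1, h2,
      mul_div_mul_left _ _ (exp_ne_zero _)]
    simp
  obtain ⟨C, -, hC⟩ := exists_bound_of_quasiperiodic hq.continuous hτ 0 hper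
  refine ⟨q 0, fun z => ?_⟩
  have hb : Bornology.IsBounded (Set.range q) := by
    refine isBounded_iff_forall_norm_le.2 ⟨C, ?_⟩
    rintro _ ⟨z, rfl⟩
    simpa using hC z
  rw [hq.apply_eq_apply_of_bounded hb 0 z]
  exact (entireQuot_mul hfg z).symm

end thetaProd

/-! ### The integrand of the hypergeometric integral as a product -/

/-- The numerator of the kernel of the hypergeometric integral. -/
def kernNum (τ σ η t : ℂ) : ℂ :=
  wprod τ σ (t - 2 * η + τ + σ) * wprod τ σ (-t - 2 * η + τ + σ)

/-- The denominator of the kernel of the hypergeometric integral. -/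
def kernDen (τ σ η t : ℂ) : ℂ := wprod τ σ (t + 2 * η) * wprod τ σ (2 * η - t)

section

variable {τ σ η : ℂ}

lemma Omega_eq (hτ : 0 < τ.im) (hσ : 0 < σ.im) (hη : 0 < η.im) (t : ℝ) :
    Omega (2 * η) t τ σ = (wprod τ σ (t - 2 * η) * wprod τ σ (-t - 2 * η + τ + σ)) /
      (wprod τ σ (t + 2 * η) * wprod τ σ (-t + 2 * η + τ + σ)) := by
  have hc := summable_wprod hτ hσ
  have h1 : wprod τ σ (t + 2 * η) ≠ 0 := wprod_ne_zero_of_im_pos hτ hσ (by simpa using hη)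
  have h2 : wprod τ σ (-t + 2 * η + τ + σ) ≠ 0 :=
    wprod_ne_zero_of_im_pos hτ hσ (by simp; linarith)
  have := ((hasProd_eprod hc (t - 2 * η)).mul (hasProd_eprod hc (-t - 2 * η + τ + σ))).div₀
    ((hasProd_eprod hc (t + 2 * η)).mul (hasProd_eprod hc (-t + 2 * η + τ + σ)))
    (mul_ne_zero h1 h2)
  refine Eq.trans ?_ this.tprod_eq
  rw [Omega]
  refine tprod_congr fun p => ?_
  simp only [qexp]
  congr 5 <;> ring_nf

/-- With z = t − 2η, peeling one row and one column off W(z) and W(−z), where W is `wprod τ σ`,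
produces the factors of the two theta products. The mismatch exp(−2πiz)(1 − exp(2πiz)) = −(1 −
exp(−2πiz)) gives the sign. -/
lemma phase_div_thetaProd (hτ : 0 < τ.im) (hσ : 0 < σ.im) (hη : 0 < η.im) (t : ℝ)
    (h1 : xprod τ (t - 2 * η) ≠ 0) (h2 : xprod σ (t - 2 * η) ≠ 0) :
    Omega (2 * η) t τ σ / (thetaProd τ (t - 2 * η) * thetaProd σ (t - 2 * η)) =
      -(kernNum τ σ η t / kernDen τ σ η t) := by
  rw [Omega_eq hτ hσ hη, kernNum, kernDen, thetaProd, thetaProd]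
  set z : ℂ := t - 2 * η with hz
  have hz' : 0 < (-z).im := by simp [hz, hη]
  have e1 : 2 * η - t = -z := by rw [hz]; ring
  have e2 : -t + 2 * η + τ + σ = -z + σ + τ := by rw [hz]; ring
  have e3 : z + τ + σ = z + σ + τ := by ring
  have e4 : τ - z = -z + τ := by ring
  have e5 : σ - z = -z + σ := by ring
  have hE : exp (-(Real.pi * I * z)) * exp (-(Real.pi * I * z)) = (qexp z)⁻¹ := by
    rw [← exp_add, ← qexp_neg, qexp]
    ring_nf
  have hden : wprod τ σ (t + 2 * η) ≠ 0 := wprod_ne_zero_of_im_pos hτ hσ (by simpa using hη)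
  rw [e1, e2, e3, e4, e5, wprod_eq_right hτ hσ z, wprod_eq_left hτ hσ (z + σ), xprod_eq hσ z,
    wprod_eq_right hτ hσ (-z), wprod_eq_left hτ hσ (-z + σ), xprod_eq hτ (-z), qexp_neg]
  have n1 : xprod σ (z + σ) ≠ 0 := by
    rw [xprod_eq hσ] at h2
    exact right_ne_zero_of_mul h2
  have n2 : 1 - qexp z ≠ 0 := by
    rw [xprod_eq hσ] at h2
    exact left_ne_zero_of_mul h2
  have n3 : xprod τ (-z + τ) ≠ 0 :=
    xprod_ne_zero_of_im_pos hτ (by rw [add_im]; linarith)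
  have n4 : xprod σ (-z + σ) ≠ 0 :=
    xprod_ne_zero_of_im_pos hσ (by rw [add_im]; linarith)
  have n5 : wprod τ σ (-z + σ + τ) ≠ 0 :=
    wprod_ne_zero_of_im_pos hτ hσ (by rw [add_im, add_im]; linarith)
  have n6 := qexp_ne_zero z
  have n7 : 1 - (qexp z)⁻¹ ≠ 0 := by
    intro h
    apply n2
    field_simp at h
    linear_combination -h
  have hE' : exp (-(Real.pi * I * z)) * (xprod τ z * xprod τ (-z + τ)) *
      (exp (-(Real.pi * I * z)) * ((1 - qexp z) * xprod σ (z + σ) * xprod σ (-z + σ))) =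
      -(1 - (qexp z)⁻¹) * (xprod τ z * xprod τ (-z + τ) * xprod σ (z + σ) * xprod σ (-z + σ)) := by
    rw [show ∀ a b c d e f : ℂ, a * (b * c) * (a * (d * e * f)) = (a * a) * d * (b * c * e * f) by
      intros; ring, hE]
    field_simp
    ring
  rw [hE']
  field_simp

lemma countable_xprod_eq_zero (hτ : 0 < τ.im) (a : ℂ) :
    {t : ℝ | xprod τ (t - a) = 0}.Countable := by
  have : ((fun t : ℝ => (t : ℂ) - a) ⁻¹' {z : ℂ | ∃ r s : ℤ, z = r + s * τ}).Countable :=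
    (countable_lattice τ).preimage fun x y h => by simpa using h
  refine this.mono fun t ht => ?_
  by_contra hne
  refine xprod_ne_zero hτ (fun j n hj => hne ⟨n, -j, ?_⟩) ht
  rw [← hj]; push_cast; ring

/-- The integrand of the hypergeometric integral, up to a constant. -/
lemma exists_uIntegrand_ae_eq (hτ : 0 < τ.im) (hσ : 0 < σ.im) :
    ∃ C : ℂ, ∀ η : ℂ, 0 < η.im → ∀ z μ : ℂ, ∀ᵐ t : ℝ,
      uIntegrand z μ τ σ η t = C * (kernNum τ σ η t / kernDen τ σ η t *
        (theta (z + t) τ * theta (μ + t) σ)) := by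
  obtain ⟨c, hc⟩ := exists_theta_eq_mul_thetaProd hτ
  obtain ⟨d, hd⟩ := exists_theta_eq_mul_thetaProd hσ
  -- There is no need to know that `c` and `d` are nonzero: if one vanishes, so does the
  -- corresponding theta function, and both sides are 0 since 0⁻¹ = 0.
  refine ⟨-(c⁻¹ * d⁻¹), fun η hη z μ => ?_⟩
  have h1 := (countable_xprod_eq_zero hτ (2 * η)).ae_notMem (volume : Measure ℝ)
  have h2 := (countable_xprod_eq_zero hσ (2 * η)).ae_notMem (volume : Measure ℝ)
  filter_upwards [h1, h2] with t ht1 ht2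
  have h := phase_div_thetaProd hτ hσ hη t ht1 ht2
  rw [uIntegrand, hc (t - 2 * η), hd (t - 2 * η)]
  have : -(c⁻¹ * d⁻¹) * (kernNum τ σ η t / kernDen τ σ η t *
      (theta (z + t) τ * theta (μ + t) σ)) = c⁻¹ * d⁻¹ * (-(kernNum τ σ η t / kernDen τ σ η t)) *
      (theta (z + t) τ * theta (μ + t) σ) := by ring
  rw [this, ← h]
  simp only [div_eq_mul_inv, mul_inv]
  ring

end

/-! ### Separating the two families of poles -/

/-- Entire functions of `(η, t)` of period one in `t`. -/
def periodicEntire : Subring (ℂ → ℂ → ℂ) where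
  carrier := {f | Differentiable ℂ (Function.uncurry f) ∧ ∀ η t, f η (t + 1) = f η t}
  zero_mem' := ⟨differentiable_const 0, by simp⟩
  one_mem' := ⟨differentiable_const 1, by simp⟩
  add_mem' := fun hf hg => ⟨hf.1.add hg.1, by simp [hf.2, hg.2]⟩
  mul_mem' := fun hf hg => ⟨hf.1.mul hg.1, by simp [hf.2, hg.2]⟩
  neg_mem' := fun hf => ⟨hf.1.neg, by simp [hf.2]⟩

/-- `r` is a combination of `u` and `v` with coefficients in the subring `A`. -/
def IsComb {R : Type*} [CommRing R] (A : Subring R) (r u v : R) : Prop :=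
  ∃ p ∈ A, ∃ q ∈ A, r = p * v + q * u

lemma IsComb.symm {R : Type*} [CommRing R] {A : Subring R} {r u v : R} (h : IsComb A r u v) :
    IsComb A r v u := by
  obtain ⟨p, hp, q, hq, rfl⟩ := h
  exact ⟨q, hq, p, hp, add_comm _ _⟩

/-- In the expanded product every term except q₁q₂u₁u₂ contains v. -/
lemma IsComb.mul {R : Type*} [CommRing R] {A : Subring R} {r₁ r₂ u₁ u₂ v : R}
    (h₁ : IsComb A r₁ u₁ v) (h₂ : IsComb A r₂ u₂ v) (hu₁ : u₁ ∈ A) (hu₂ : u₂ ∈ A) (hv : v ∈ A) :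
    IsComb A (r₁ * r₂) (u₁ * u₂) v := by
  obtain ⟨p₁, hp₁, q₁, hq₁, rfl⟩ := h₁
  obtain ⟨p₂, hp₂, q₂, hq₂, rfl⟩ := h₂
  exact ⟨p₁ * p₂ * v + p₁ * q₂ * u₂ + q₁ * p₂ * u₁, A.add_mem (A.add_mem
    (A.mul_mem (A.mul_mem hp₁ hp₂) hv) (A.mul_mem (A.mul_mem hp₁ hq₂) hu₂))
    (A.mul_mem (A.mul_mem hq₁ hp₂) hu₁), q₁ * q₂, A.mul_mem hq₁ hq₂, by ring⟩

lemma IsComb.prod {R ι : Type*} [CommRing R] {A : Subring R} {r u : ι → R} {v : R}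
    (s : Finset ι) (h : ∀ i, IsComb A (r i) (u i) v) (hu : ∀ i, u i ∈ A) (hv : v ∈ A) :
    IsComb A (∏ i ∈ s, r i) (∏ i ∈ s, u i) v := by
  classical
  induction s using Finset.induction_on with
  | empty => exact ⟨0, A.zero_mem, 1, A.one_mem, by simp⟩
  | insert i s hi ih =>
    rw [Finset.prod_insert hi, Finset.prod_insert hi]
    exact (h i).mul ih (hu i) (A.prod_mem fun j _ => hu j) hv

/-- For x = `qexp (t + 2η + c i)` and y = `qexp (2η − t + c j)` one has 1 − xy = (1 − y) + y(1 − x),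
and xy does not involve t. Multiplying over all pairs keeps this form. The left side vanishes
exactly when one of the chosen lower poles meets an upper one modulo ℤ. -/
lemma exists_bezout {ι : Type*} (c : ι → ℂ) (s : Finset ι) :
    ∃ p ∈ periodicEntire, ∃ q ∈ periodicEntire, ∀ η t : ℂ,
      ∏ i ∈ s, ∏ j ∈ s, (1 - qexp (4 * η + c i + c j)) =
        p η t * ∏ i ∈ s, (1 - qexp (2 * η - t + c i)) +
          q η t * ∏ i ∈ s, (1 - qexp (t + 2 * η + c i)) := by
  have hE := differentiable_qexp
  set u : ι → ℂ → ℂ → ℂ := fun i η t => 1 - qexp (t + 2 * η + c i)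
  set v : ι → ℂ → ℂ → ℂ := fun i η t => 1 - qexp (2 * η - t + c i)
  have hu : ∀ i, u i ∈ periodicEntire := fun i => by
    refine ⟨?_, fun η t => ?_⟩
    · exact (hE.comp (by fun_prop :
        Differentiable ℂ fun x : ℂ × ℂ => x.2 + 2 * x.1 + c i)).const_sub 1
    · simp [u, qexp_add]
  have hv : ∀ i, v i ∈ periodicEntire := fun i => by
    refine ⟨?_, fun η t => ?_⟩
    · exact (hE.comp (by fun_prop :
        Differentiable ℂ fun x : ℂ × ℂ => 2 * x.1 - x.2 + c i)).const_sub 1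
    · simp [v, qexp_add, sub_eq_add_neg, qexp_neg]
  have hw : ∀ i, (fun η t => qexp (2 * η - t + c i)) ∈ periodicEntire := fun i => by
    refine ⟨?_, fun η t => ?_⟩
    · exact hE.comp (by fun_prop :
        Differentiable ℂ fun x : ℂ × ℂ => 2 * x.1 - x.2 + c i)
    · simp [qexp_add, sub_eq_add_neg, qexp_neg]
  have h1 : ∀ i j, IsComb periodicEntire (fun η _ => 1 - qexp (4 * η + c i + c j)) (u i) (v j) := by
    intro i j
    refine ⟨1, periodicEntire.one_mem, fun η t => qexp (2 * η - t + c j), hw j, ?_⟩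
    ext η t
    have : qexp (4 * η + c i + c j) = qexp (2 * η - t + c j) * qexp (t + 2 * η + c i) := by
      rw [← qexp_add]
      ring_nf
    simp only [Pi.add_apply, Pi.mul_apply, Pi.one_apply, u, v, this]
    ring
  have h2 : IsComb periodicEntire
      (∏ i ∈ s, ∏ j ∈ s, fun η _ => 1 - qexp (4 * η + c i + c j)) (∏ i ∈ s, u i) (∏ j ∈ s, v j) :=
    IsComb.prod s (fun i => (IsComb.prod s (fun j => (h1 i j).symm) hv (hu i)).symm) hu
      (periodicEntire.prod_mem fun j _ => hv j)
  obtain ⟨p, hp, q, hq, h⟩ := h2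
  refine ⟨p, hp, q, hq, fun η t => ?_⟩
  simpa [u, v, Finset.prod_apply] using congr_fun (congr_fun h η) t

/-! ### Analytic continuation of the hypergeometric integral -/

/-- The points `j τ + k σ`. -/
def cone (τ σ : ℂ) (p : ℕ × ℕ) : ℂ := (p.1 : ℂ) * τ + p.2 * σ

/-- The square `{0, …, M - 1}²`. -/
def square (M : ℕ) : Finset (ℕ × ℕ) := Finset.range M ×ˢ Finset.range M

/-- The factors of `wprod` with index outside of `square M`. -/
def wtail (τ σ : ℂ) (M : ℕ) (w : ℂ) : ℂ :=
  eprod (fun p : {p // p ∉ square M} => cone τ σ p) w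

/-- The finite product of the polar factors in `η` with indices in `square M`. -/
def polar (τ σ : ℂ) (M : ℕ) (η : ℂ) : ℂ :=
  ∏ p ∈ square M, ∏ q ∈ square M, (1 - qexp (4 * η + cone τ σ p + cone τ σ q))

/-- The height of the contours used for the analytic continuation at level `M`. -/
def height (τ σ : ℂ) (M : ℕ) : ℝ := M * min τ.im σ.im / 2

/-- The sum of two integrals over horizontal contours at heights `± Y`. -/
def contourInt (Y : ℝ) (A B : ℂ → ℂ → ℂ) (H : ℂ → ℂ → ℂ) (η : ℂ) : ℂ :=
  (∫ t in (0 : ℝ)..1, A η (t + Y * I) * H η (t + Y * I)) +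
    ∫ t in (0 : ℝ)..1, B η (t - Y * I) * H η (t - Y * I)

section

variable {τ σ : ℂ}

lemma summable_wtail (hτ : 0 < τ.im) (hσ : 0 < σ.im) (M : ℕ) :
    Summable fun p : {p // p ∉ square M} => ‖qexp (cone τ σ p)‖ :=
  (summable_wprod hτ hσ).comp_injective Subtype.val_injective

lemma differentiable_wtail (hτ : 0 < τ.im) (hσ : 0 < σ.im) (M : ℕ) :
    Differentiable ℂ (wtail τ σ M) :=
  differentiable_eprod (summable_wtail hτ hσ M)

lemma wprod_eq_prod_mul_wtail (hτ : 0 < τ.im) (hσ : 0 < σ.im) (M : ℕ) (w : ℂ) :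
    wprod τ σ w = (∏ p ∈ square M, (1 - qexp (w + cone τ σ p))) * wtail τ σ M w :=
  eprod_eq_prod_mul (summable_wprod hτ hσ) (square M) w

/-- An index outside the square has a coordinate at least M, so its cone point has imaginary part at
least M · min(Im τ, Im σ), which is twice the height. -/
lemma wtail_ne_zero (hτ : 0 < τ.im) (hσ : 0 < σ.im) (M : ℕ) {w : ℂ}
    (hw : 0 < w.im + 2 * height τ σ M) : wtail τ σ M w ≠ 0 := by
  refine eprod_ne_zero (summable_wtail hτ hσ M) fun p => qexp_ne_one_of_im_pos ?_
  obtain ⟨⟨j, k⟩, hp⟩ := p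
  have hm : (M : ℝ) ≤ j ∨ (M : ℝ) ≤ k := by
    simp only [square, Finset.mem_product, Finset.mem_range, not_and_or, not_lt] at hp
    exact_mod_cast hp
  have hmin : 0 < min τ.im σ.im := lt_min hτ hσ
  have h1 : (j : ℝ) * min τ.im σ.im ≤ j * τ.im := by gcongr; exact min_le_left _ _
  have h2 : (k : ℝ) * min τ.im σ.im ≤ k * σ.im := by gcongr; exact min_le_right _ _
  have h3 : (M : ℝ) * min τ.im σ.im ≤ j * τ.im + k * σ.im := by
    have hj : 0 ≤ (j : ℝ) * min τ.im σ.im := by positivity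
    have hk : 0 ≤ (k : ℝ) * min τ.im σ.im := by positivity
    rcases hm with h | h
    · have : (M : ℝ) * min τ.im σ.im ≤ j * min τ.im σ.im := by gcongr
      linarith
    · have : (M : ℝ) * min τ.im σ.im ≤ k * min τ.im σ.im := by gcongr
      linarith
  rw [height] at hw
  simp [cone]
  linarith

lemma wtail_add_int (M : ℕ) (w : ℂ) (n : ℤ) : wtail τ σ M (w + n) = wtail τ σ M w :=
  eprod_add_int _ _ _

lemma height_nonneg (hτ : 0 < τ.im) (hσ : 0 < σ.im) (M : ℕ) : 0 ≤ height τ σ M := by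
  have hmin : 0 < min τ.im σ.im := lt_min hτ hσ
  rw [height]
  positivity

/-- The half plane of convergence of the contour integrals at level `M`. -/
def levelDomain (τ σ : ℂ) (M : ℕ) : Set ℂ := {η | -(height τ σ M / 2) < η.im}

lemma isOpen_levelDomain (M : ℕ) : IsOpen (levelDomain τ σ M) :=
  isOpen_lt continuous_const continuous_im

lemma isPreconnected_levelDomain (M : ℕ) : IsPreconnected (levelDomain τ σ M) :=
  (convex_halfSpace_im_gt _).isPreconnected

lemma differentiableOn_contourInt {Y : ℝ} {A B H : ℂ → ℂ → ℂ} {s : Set ℂ} (hs : IsOpen s)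
    (hA : ∀ η ∈ s, ∀ t : ℂ, t.im = Y → DifferentiableAt ℂ (Function.uncurry A) (η, t))
    (hB : ∀ η ∈ s, ∀ t : ℂ, t.im = -Y → DifferentiableAt ℂ (Function.uncurry B) (η, t))
    (hH : Differentiable ℂ (Function.uncurry H)) :
    DifferentiableOn ℂ (contourInt Y A B H) s := by
  have key : ∀ (C : ℂ → ℂ → ℂ) (v : ℂ),
      (∀ η ∈ s, ∀ t : ℂ, t.im = v.im → DifferentiableAt ℂ (Function.uncurry C) (η, t)) →
      DifferentiableOn ℂ (fun η => ∫ t in (0 : ℝ)..1, C η (t + v) * H η (t + v)) s := by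
    intro C v hC
    have hC' : ∀ η ∈ s, ∀ t : ℝ, DifferentiableAt ℂ
        (fun x : ℂ × ℂ => C x.1 x.2 * H x.1 x.2) (η, (t : ℂ) + v) := fun η hη t =>
      (hC η hη (t + v) (by simp)).mul (hH (η, t + v))
    refine differentiableOn_intervalIntegral hs (fun p hp => ?_) fun t _ η hη => ?_
    · have h1 : ContinuousAt (fun p : ℂ × ℝ => (p.1, (p.2 : ℂ) + v)) p := by fun_prop
      exact (ContinuousAt.comp (f := fun p : ℂ × ℝ => (p.1, (p.2 : ℂ) + v))
        (hC' p.1 hp.1 p.2).continuousAt h1).continuousWithinAt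
    · have h1 : DifferentiableAt ℂ (fun η : ℂ => (η, (t : ℂ) + v)) η := by fun_prop
      exact (DifferentiableAt.comp η (hC' η hη t) h1).differentiableWithinAt
  have h1 := key A (Y * I) (by simpa using hA)
  have h2 := key B (-(Y * I)) (by simpa using hB)
  simp only [← sub_eq_add_neg] at h2
  exact h1.add h2

/-- The kernels on the two contours at level `M`: the integrals over these contours are holomorphic
in the half plane `levelDomain τ σ M`, and compute the hypergeometric integral, multiplied by the
polar factors, for `Im η > 0`. -/
structure IsLevel (τ σ : ℂ) (M : ℕ) (A B : ℂ → ℂ → ℂ) : Prop where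
  left : ∀ η ∈ levelDomain τ σ M, ∀ t : ℂ, t.im = height τ σ M →
    DifferentiableAt ℂ (Function.uncurry A) (η, t)
  right : ∀ η ∈ levelDomain τ σ M, ∀ t : ℂ, t.im = -height τ σ M →
    DifferentiableAt ℂ (Function.uncurry B) (η, t)
  eq_integral : ∀ η : ℂ, 0 < η.im → ∀ H : ℂ → ℂ → ℂ, Differentiable ℂ (H η) →
    (∀ t, H η (t + 1) = H η t) → contourInt (height τ σ M) A B H η =
      polar τ σ M η * ∫ t in (0 : ℝ)..1, kernNum τ σ η t / kernDen τ σ η t * H η t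

lemma differentiable_kernNum (hτ : 0 < τ.im) (hσ : 0 < σ.im) :
    Differentiable ℂ fun x : ℂ × ℂ => kernNum τ σ x.1 x.2 := by
  have := differentiable_wprod hτ hσ
  unfold kernNum
  fun_prop

lemma kernNum_add_one (η t : ℂ) : kernNum τ σ η (t + 1) = kernNum τ σ η t := by
  have h1 : t + 1 - 2 * η + τ + σ = t - 2 * η + τ + σ + (1 : ℤ) := by push_cast; ring
  have h2 : -(t + 1) - 2 * η + τ + σ = -t - 2 * η + τ + σ + (-1 : ℤ) := by push_cast; ring
  rw [kernNum, h1, h2, wprod_add_int, wprod_add_int, kernNum]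

lemma exists_isLevel (hτ : 0 < τ.im) (hσ : 0 < σ.im) (M : ℕ) :
    ∃ A B : ℂ → ℂ → ℂ, IsLevel τ σ M A B := by
  obtain ⟨p, hp, q, hq, hpq⟩ := exists_bezout (cone τ σ) (square M)
  have hW := differentiable_wprod hτ hσ
  have hV := differentiable_wtail hτ hσ M
  have hN := differentiable_kernNum hτ hσ
  have hp1 : Differentiable ℂ fun x : ℂ × ℂ => p x.1 x.2 := hp.1
  have hq1 : Differentiable ℂ fun x : ℂ × ℂ => q x.1 x.2 := hq.1
  have hY := height_nonneg hτ hσ M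
  set Y := height τ σ M with hYdef
  -- In the term with `p` the Bezout identity cancels the first factors of W(2η − t), hence the
  -- nearest upper poles, so `A` permits a contour at height Y. In `B`, below, the nearest lower
  -- poles are cancelled and the contour sits at −Y.
  set A : ℂ → ℂ → ℂ := fun η t =>
    kernNum τ σ η t * p η t / (wprod τ σ (t + 2 * η) * wtail τ σ M (2 * η - t)) with hA
  set B : ℂ → ℂ → ℂ := fun η t =>
    kernNum τ σ η t * q η t / (wtail τ σ M (t + 2 * η) * wprod τ σ (2 * η - t)) with hB
  have dA : ∀ η t : ℂ, 0 < t.im + 2 * η.im → 0 < 2 * η.im - t.im + 2 * Y →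
      DifferentiableAt ℂ (Function.uncurry A) (η, t) := by
    intro η t h1 h2
    have n1 : wprod τ σ (t + 2 * η) ≠ 0 :=
      wprod_ne_zero_of_im_pos hτ hσ (by simpa using h1)
    have n2 : wtail τ σ M (2 * η - t) ≠ 0 := wtail_ne_zero hτ hσ M (by simpa using h2)
    have hd : Differentiable ℂ fun x : ℂ × ℂ =>
        wprod τ σ (x.2 + 2 * x.1) * wtail τ σ M (2 * x.1 - x.2) := by fun_prop
    have hn := ((hN.mul hp1) (η, t)).mul ((hd (η, t)).inv (mul_ne_zero n1 n2))
    exact hn.congr_of_eventuallyEq (.of_forall fun x => div_eq_mul_inv _ _)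
  have dB : ∀ η t : ℂ, 0 < 2 * η.im - t.im → 0 < t.im + 2 * η.im + 2 * Y →
      DifferentiableAt ℂ (Function.uncurry B) (η, t) := by
    intro η t h1 h2
    have n1 : wprod τ σ (2 * η - t) ≠ 0 :=
      wprod_ne_zero_of_im_pos hτ hσ (by simpa using h1)
    have n2 : wtail τ σ M (t + 2 * η) ≠ 0 := wtail_ne_zero hτ hσ M (by simpa using h2)
    have hd : Differentiable ℂ fun x : ℂ × ℂ =>
        wtail τ σ M (x.2 + 2 * x.1) * wprod τ σ (2 * x.1 - x.2) := by fun_prop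
    have hn := ((hN.mul hq1) (η, t)).mul ((hd (η, t)).inv (mul_ne_zero n2 n1))
    exact hn.congr_of_eventuallyEq (.of_forall fun x => div_eq_mul_inv _ _)
  have perA : ∀ η t, A η (t + 1) = A η t := by
    intro η t
    have h1 : t + 1 + 2 * η = t + 2 * η + (1 : ℤ) := by push_cast; ring
    have h2 : 2 * η - (t + 1) = 2 * η - t + (-1 : ℤ) := by push_cast; ring
    simp only [hA]
    rw [kernNum_add_one, hp.2, h1, h2, wprod_add_int, wtail_add_int]
  have perB : ∀ η t, B η (t + 1) = B η t := by
    intro η t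
    have h1 : t + 1 + 2 * η = t + 2 * η + (1 : ℤ) := by push_cast; ring
    have h2 : 2 * η - (t + 1) = 2 * η - t + (-1 : ℤ) := by push_cast; ring
    simp only [hB]
    rw [kernNum_add_one, hq.2, h1, h2, wprod_add_int, wtail_add_int]
  refine ⟨A, B, fun η hη t ht => dA η t ?_ ?_, fun η hη t ht => dB η t ?_ ?_,
    fun η hη H hH hper => ?_⟩
  any_goals
    rw [levelDomain, Set.mem_ofPred_eq] at hη
    rw [ht]
    linarith
  have slice : ∀ C : ℂ → ℂ → ℂ, ∀ t : ℂ, DifferentiableAt ℂ (Function.uncurry C) (η, t) →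
      DifferentiableAt ℂ (fun t => C η t * H η t) t := by
    intro C t hC
    exact (DifferentiableAt.comp t hC (by fun_prop : DifferentiableAt ℂ (fun t => (η, t)) t)).mul
      (hH t)
  -- For Im η > 0 both contours can return to the real axis without meeting a pole; there the two
  -- integrands add up by the Bezout identity.
  have eA := integral_periodic_eq_of_mem_strip (g := fun t => A η t * H η t)
    (a := -(2 * η.im)) (b := 2 * η.im + 2 * Y)
    (fun t ht => (slice A t (dA η t (by linarith [ht.1]) (by linarith [ht.2]))).differentiableWithinAt)
    (fun z => by rw [perA, hper]) (v := Y * I) (w := 0)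
    ⟨by simp; linarith, by simp; linarith⟩ ⟨by simp; linarith, by simp; linarith⟩
  have eB := integral_periodic_eq_of_mem_strip (g := fun t => B η t * H η t)
    (a := -(2 * η.im + 2 * Y)) (b := 2 * η.im)
    (fun t ht => (slice B t (dB η t (by linarith [ht.2]) (by linarith [ht.1]))).differentiableWithinAt)
    (fun z => by rw [perB, hper]) (v := -(Y * I)) (w := 0)
    ⟨by simp; linarith, by simp; linarith⟩ ⟨by simp; linarith, by simp; linarith⟩
  simp only [← sub_eq_add_neg, add_zero] at eA eB
  rw [contourInt, eA, eB, ← intervalIntegral.integral_const_mul,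
    ← intervalIntegral.integral_add]
  · refine intervalIntegral.integral_congr fun t _ => ?_
    have n1 : wprod τ σ (t + 2 * η) ≠ 0 :=
      wprod_ne_zero_of_im_pos hτ hσ (by simpa using hη)
    have n2 : wprod τ σ (2 * η - t) ≠ 0 :=
      wprod_ne_zero_of_im_pos hτ hσ (by simpa using hη)
    have e1 := wprod_eq_prod_mul_wtail hτ hσ M (t + 2 * η)
    have e2 := wprod_eq_prod_mul_wtail hτ hσ M (2 * η - t)
    have e3 : polar τ σ M η = _ := hpq η t
    simp only [hA, hB, kernDen]
    rw [e3]
    rw [e1] at n1 ⊢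
    rw [e2] at n2 ⊢
    have m1 := left_ne_zero_of_mul n1
    have m2 := right_ne_zero_of_mul n1
    have m3 := left_ne_zero_of_mul n2
    have m4 := right_ne_zero_of_mul n2
    field_simp
  all_goals
    refine ContinuousOn.intervalIntegrable fun t _ => ContinuousAt.continuousWithinAt ?_
    refine ContinuousAt.comp (g := fun t : ℂ => _ * H η t) (f := fun t : ℝ => (t : ℂ)) ?_
      (by fun_prop)
  · exact (slice A t (dA η t (by simpa using hη) (by simp; linarith))).continuousAt
  · exact (slice B t (dB η t (by simpa using hη) (by simp; linarith))).continuousAt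

end

section

variable {τ σ : ℂ}

lemma differentiable_polar (M : ℕ) : Differentiable ℂ (polar τ σ M) := by
  have := differentiable_qexp
  unfold polar
  fun_prop

lemma polar_ne_zero_of_le {M M' : ℕ} (h : M ≤ M') {η : ℂ} (hη : polar τ σ M' η ≠ 0) :
    polar τ σ M η ≠ 0 := by
  have hsub : square M ⊆ square M' := by
    intro p hp
    simp only [square, Finset.mem_product, Finset.mem_range] at hp ⊢
    exact ⟨hp.1.trans_le h, hp.2.trans_le h⟩
  simp only [polar, Finset.prod_ne_zero_iff] at hη ⊢
  exact fun p hp q hq => hη p (hsub hp) q (hsub hq)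

lemma polar_ne_zero {η : ℂ} (hη : η ∈ regularSet τ σ) (M : ℕ) : polar τ σ M η ≠ 0 := by
  simp only [polar, Finset.prod_ne_zero_iff]
  intro p _ q _ h
  obtain ⟨n, hn⟩ := qexp_eq_one_iff.1 (sub_eq_zero.1 h).symm
  refine hη (-n) (p.1 + q.1) (p.2 + q.2) ?_
  simp only [cone] at hn
  push_cast
  linear_combination hn

lemma mem_levelDomain_of_im_pos (hτ : 0 < τ.im) (hσ : 0 < σ.im) (M : ℕ) {η : ℂ}
    (hη : 0 < η.im) : η ∈ levelDomain τ σ M := by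
  have := height_nonneg hτ hσ M
  rw [levelDomain, Set.mem_ofPred_eq]
  linarith

/-- The identity theorem on a half plane: every relation verified for Im η > 0 extends through this
lemma. -/
lemma eqOn_levelDomain (hτ : 0 < τ.im) (hσ : 0 < σ.im) (M : ℕ) {f g : ℂ → ℂ}
    (hf : DifferentiableOn ℂ f (levelDomain τ σ M)) (hg : DifferentiableOn ℂ g (levelDomain τ σ M))
    (hfg : ∀ η : ℂ, 0 < η.im → f η = g η) : Set.EqOn f g (levelDomain τ σ M) := by
  have hI : (0 : ℝ) < (I : ℂ).im := by simp
  refine (hf.analyticOnNhd (isOpen_levelDomain M)).eqOn_of_preconnected_of_eventuallyEq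
    (hg.analyticOnNhd (isOpen_levelDomain M)) (isPreconnected_levelDomain M)
    (mem_levelDomain_of_im_pos hτ hσ M hI) ?_
  filter_upwards [(isOpen_lt continuous_const continuous_im).mem_nhds hI] with w hw
  exact hfg w hw

lemma levelDomain_mono (hτ : 0 < τ.im) (hσ : 0 < σ.im) {M M' : ℕ} (h : M ≤ M') :
    levelDomain τ σ M ⊆ levelDomain τ σ M' := by
  intro η hη
  have hmin : 0 < min τ.im σ.im := lt_min hτ hσ
  have : height τ σ M ≤ height τ σ M' := by
    unfold height
    gcongr
  rw [levelDomain, Set.mem_ofPred_eq] at hη ⊢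
  linarith

/-- A level whose domain contains `η`. -/
def level (τ σ η : ℂ) : ℕ := ⌈-(4 * η.im) / min τ.im σ.im⌉₊ + 1

lemma mem_levelDomain_level (hτ : 0 < τ.im) (hσ : 0 < σ.im) (η : ℂ) :
    η ∈ levelDomain τ σ (level τ σ η) := by
  have hmin : 0 < min τ.im σ.im := lt_min hτ hσ
  -- The ceiling only gives a weak inequality; the `+ 1` in `level` makes it strict, as the open
  -- half plane requires.
  have h1 := Nat.le_ceil (-(4 * η.im) / min τ.im σ.im)
  rw [div_le_iff₀ hmin] at h1
  rw [levelDomain, Set.mem_ofPred_eq, height, level]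
  push_cast
  linarith

lemma level_mono (hτ : 0 < τ.im) (hσ : 0 < σ.im) {η η' : ℂ} (h : η'.im ≤ η.im) :
    level τ σ η ≤ level τ σ η' := by
  have hmin : 0 < min τ.im σ.im := lt_min hτ hσ
  unfold level
  gcongr

namespace IsLevel

lemma differentiableOn {M : ℕ} {A B : ℂ → ℂ → ℂ} (h : IsLevel τ σ M A B) {H : ℂ → ℂ → ℂ}
    (hH : Differentiable ℂ (Function.uncurry H)) :
    DifferentiableOn ℂ (contourInt (height τ σ M) A B H) (levelDomain τ σ M) :=
  differentiableOn_contourInt (isOpen_levelDomain M) h.left h.right hH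

lemma differentiable_slice {H : ℂ → ℂ → ℂ} (hH : Differentiable ℂ (Function.uncurry H)) (η : ℂ) :
    Differentiable ℂ (H η) :=
  hH.comp (by fun_prop : Differentiable ℂ fun t : ℂ => (η, t))

lemma contourInt_congr (hτ : 0 < τ.im) (hσ : 0 < σ.im) {M : ℕ} {A B : ℂ → ℂ → ℂ}
    (h : IsLevel τ σ M A B) {H H' : ℂ → ℂ → ℂ}
    (hH : Differentiable ℂ (Function.uncurry H)) (hH' : Differentiable ℂ (Function.uncurry H'))
    (hper : ∀ η t, H η (t + 1) = H η t) (hper' : ∀ η t, H' η (t + 1) = H' η t)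
    (heq : ∀ η : ℂ, 0 < η.im →
      ∫ t in (0 : ℝ)..1, kernNum τ σ η t / kernDen τ σ η t * H η t =
        ∫ t in (0 : ℝ)..1, kernNum τ σ η t / kernDen τ σ η t * H' η t) :
    Set.EqOn (contourInt (height τ σ M) A B H) (contourInt (height τ σ M) A B H')
      (levelDomain τ σ M) :=
  eqOn_levelDomain hτ hσ M (h.differentiableOn hH) (h.differentiableOn hH') fun η hη => by
    rw [h.eq_integral η hη H (differentiable_slice hH η) (hper η),
      h.eq_integral η hη H' (differentiable_slice hH' η) (hper' η), heq η hη]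

/-- Different levels define the same function. Cross-multiplying keeps both sides holomorphic even
where polar factors vanish. -/
lemma contourInt_mul_polar (hτ : 0 < τ.im) (hσ : 0 < σ.im) {M M' : ℕ} {A B A' B' : ℂ → ℂ → ℂ}
    (h : IsLevel τ σ M A B) (h' : IsLevel τ σ M' A' B') (hM : M ≤ M') {H : ℂ → ℂ → ℂ}
    (hH : Differentiable ℂ (Function.uncurry H)) (hper : ∀ η t, H η (t + 1) = H η t) :
    ∀ η ∈ levelDomain τ σ M, contourInt (height τ σ M) A B H η * polar τ σ M' η =
      contourInt (height τ σ M') A' B' H η * polar τ σ M η := by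
  refine eqOn_levelDomain hτ hσ M
    ((h.differentiableOn hH).mul (differentiable_polar M').differentiableOn)
    (((h'.differentiableOn hH).mono (levelDomain_mono hτ hσ hM)).mul
      (differentiable_polar M).differentiableOn) fun η hη => ?_
  rw [h.eq_integral η hη H (differentiable_slice hH η) (hper η),
    h'.eq_integral η hη H (differentiable_slice hH η) (hper η)]
  ring

end IsLevel

/-- The theta factors of the integrand. -/
def thetaPair (τ σ z μ t : ℂ) : ℂ := theta (z + t) τ * theta (μ + t) σ

lemma differentiable_thetaPair (hτ : 0 < τ.im) (hσ : 0 < σ.im) (z μ : ℂ) :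
    Differentiable ℂ (thetaPair τ σ z μ) := by
  have h1 := differentiable_theta hτ
  have h2 := differentiable_theta hσ
  exact (h1.comp (differentiable_id.const_add z)).mul (h2.comp (differentiable_id.const_add μ))

lemma thetaPair_add_one (z μ t : ℂ) : thetaPair τ σ z μ (t + 1) = thetaPair τ σ z μ t := by
  rw [thetaPair, ← add_assoc, ← add_assoc, theta_add_one, theta_add_one, neg_mul_neg, thetaPair]

lemma kernDen_ne_zero (hτ : 0 < τ.im) (hσ : 0 < σ.im) {η t : ℂ} (h1 : 0 < t.im + 2 * η.im)
    (h2 : 0 < 2 * η.im - t.im) : kernDen τ σ η t ≠ 0 :=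
  mul_ne_zero (wprod_ne_zero_of_im_pos hτ hσ (by simpa using h1))
    (wprod_ne_zero_of_im_pos hτ hσ (by simpa using h2))

lemma continuous_kern (hτ : 0 < τ.im) (hσ : 0 < σ.im) {η : ℂ} (hη : 0 < η.im) :
    Continuous fun t : ℝ => kernNum τ σ η t / kernDen τ σ η t := by
  have h := (differentiable_wprod hτ hσ).continuous
  refine Continuous.div (by unfold kernNum; fun_prop) (by unfold kernDen; fun_prop) fun t => ?_
  exact kernDen_ne_zero hτ hσ (by simpa using hη) (by simpa using hη)

/-- The analytic continuation of the hypergeometric integral, in terms of contour integrals. -/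
lemma exists_isContinuation (hτ : 0 < τ.im) (hσ : 0 < σ.im) :
    ∃ C : ℂ, ∀ z μ : ℂ, ∃ F : ℂ → ℂ, IsContinuation z μ τ σ F ∧
      ∀ (M : ℕ) (A B : ℂ → ℂ → ℂ), IsLevel τ σ M A B →
        ∀ η ∈ levelDomain τ σ M, η ∈ regularSet τ σ →
          F η = exp (-(Real.pi * I * z * μ / (2 * η))) * (C *
            (contourInt (height τ σ M) A B (fun _ => thetaPair τ σ z μ) η / polar τ σ M η)) := by
  obtain ⟨C, hC⟩ := exists_uIntegrand_ae_eq hτ hσ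
  choose A B hAB using exists_isLevel (τ := τ) (σ := σ) hτ hσ
  refine ⟨C, fun z μ => ?_⟩
  set H : ℂ → ℂ → ℂ := fun _ => thetaPair τ σ z μ
  have hH : Differentiable ℂ (Function.uncurry H) :=
    (differentiable_thetaPair hτ hσ z μ).comp differentiable_snd
  have hper : ∀ η t, H η (t + 1) = H η t := fun _ t => thetaPair_add_one z μ t
  set F : ℂ → ℂ := fun η => exp (-(Real.pi * I * z * μ / (2 * η))) * (C *
    (contourInt (height τ σ (level τ σ η)) (A (level τ σ η)) (B (level τ σ η)) H η /
      polar τ σ (level τ σ η) η)) with hF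
  have hquot : ∀ (M M' : ℕ) (A B A' B' : ℂ → ℂ → ℂ), IsLevel τ σ M A B → IsLevel τ σ M' A' B' →
      M ≤ M' → ∀ η ∈ levelDomain τ σ M, polar τ σ M' η ≠ 0 →
      contourInt (height τ σ M) A B H η / polar τ σ M η =
        contourInt (height τ σ M') A' B' H η / polar τ σ M' η := by
    intro M M' A B A' B' h h' hM η hη hpol
    rw [div_eq_div_iff (polar_ne_zero_of_le hM hpol) hpol]
    exact h.contourInt_mul_polar hτ hσ h' hM hH hper η hη
  have hform : ∀ (M : ℕ) (A B : ℂ → ℂ → ℂ), IsLevel τ σ M A B →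
      ∀ η ∈ levelDomain τ σ M, η ∈ regularSet τ σ →
        F η = exp (-(Real.pi * I * z * μ / (2 * η))) * (C *
          (contourInt (height τ σ M) A B H η / polar τ σ M η)) := by
    intro M A₁ B₁ h η hη hreg
    simp only [hF]
    congr 2
    rcases le_total (level τ σ η) M with hle | hle
    · exact hquot _ _ _ _ _ _ (hAB _) h hle η (mem_levelDomain_level hτ hσ η)
        (polar_ne_zero hreg _)
    · exact (hquot _ _ _ _ _ _ h (hAB _) hle η hη (polar_ne_zero hreg _)).symm
  refine ⟨F, ⟨fun η₀ hη₀ => ?_, fun η hη => ?_, fun η hη => ?_⟩, hform⟩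
  -- The level defining `F` jumps with η. One level that works for all Im η > Im η₀ − 1 gives a
  -- single holomorphic formula `G` near η₀, and only the finitely many polar factors of that level
  -- have to be nonzero there.
  · set M := level τ σ (η₀ - I)
    set G : ℂ → ℂ := fun η => exp (-(Real.pi * I * z * μ / (2 * η))) * (C *
      (contourInt (height τ σ M) (A M) (B M) H η / polar τ σ M η)) with hG
    set s : Set ℂ := {η | η₀.im - 1 < η.im} ∩ {η | polar τ σ M η ≠ 0} ∩ {η | η ≠ 0}
    have hs : IsOpen s := ((isOpen_lt continuous_const continuous_im).inter
      (isOpen_ne_fun (differentiable_polar M).continuous continuous_const)).inter isOpen_ne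
    have hη₀s : η₀ ∈ s := by
      refine ⟨⟨by simp, polar_ne_zero hη₀ M⟩, ?_⟩
      rintro rfl
      simpa using hη₀ 0 0 0
    have hsub : s ⊆ levelDomain τ σ M := by
      intro η hη
      have h1 := mem_levelDomain_level hτ hσ (η₀ - I)
      have h2 := hη.1.1
      rw [levelDomain, Set.mem_ofPred_eq] at h1 ⊢
      rw [Set.mem_ofPred_eq] at h2
      rw [sub_im, I_im] at h1
      exact h1.trans h2
    have hGd : DifferentiableOn ℂ G s := by
      have h1 := ((hAB M).differentiableOn hH).mono hsub
      have h2 := (differentiable_polar (τ := τ) (σ := σ) M).differentiableOn (s := s)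
      have h3 : DifferentiableOn ℂ (fun η : ℂ => exp (-(Real.pi * I * z * μ / (2 * η)))) s := by
        intro η hη
        have : (2 * η : ℂ) ≠ 0 := mul_ne_zero two_ne_zero hη.2
        exact DifferentiableAt.differentiableWithinAt (by fun_prop (disch := assumption))
      exact h3.mul ((h1.div h2 fun η hη => hη.1.2).const_mul C)
    refine (hGd.analyticAt (hs.mem_nhds hη₀s)).congr ?_
    filter_upwards [hs.mem_nhds hη₀s] with η hη
    simp only [hG, hF]
    congr 2
    refine (hquot _ _ _ _ _ _ (hAB _) (hAB _) (level_mono hτ hσ ?_) η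
      (mem_levelDomain_level hτ hσ η) hη.1.2).symm
    have := hη.1.1
    simp at this ⊢
    linarith
  · have hcont : Continuous fun t : ℝ => C * (kernNum τ σ η t / kernDen τ σ η t *
        (theta (z + t) τ * theta (μ + t) σ)) := by
      have := (differentiable_theta hτ).continuous
      have := (differentiable_theta hσ).continuous
      have := continuous_kern hτ hσ hη
      fun_prop
    refine (hcont.intervalIntegrable 0 1).congr_ae (ae_restrict_of_ae ?_)
    filter_upwards [hC η hη z μ] with t ht using ht.symm
  · have hreg := upper_subset_regularSet hτ hσ hη
    rw [hform 0 _ _ (hAB 0) η (mem_levelDomain_of_im_pos hτ hσ 0 hη) hreg,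
      (hAB 0).eq_integral η hη H (differentiable_thetaPair hτ hσ z μ) (hper η),
      mul_div_cancel_left₀ _ (polar_ne_zero hreg 0), uUpper, ← intervalIntegral.integral_const_mul]
    congr 1
    refine intervalIntegral.integral_congr_ae ?_
    filter_upwards [hC η hη z μ] with t ht _
    exact ht.symm

/-! ### Symmetries of the hypergeometric integral -/

lemma kern_neg (η t : ℂ) : kernNum τ σ η (-t) / kernDen τ σ η (-t) =
    kernNum τ σ η t / kernDen τ σ η t := by
  rw [kernNum, kernDen, kernNum, kernDen, neg_neg, mul_comm (wprod τ σ (-t - _ + _ + _)),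
    sub_neg_eq_add, add_comm (-t), ← sub_eq_add_neg, add_comm (2 * η) t,
    mul_comm (wprod τ σ (2 * η - t))]

lemma kern_add_one (η t : ℂ) : kernNum τ σ η (t + 1) / kernDen τ σ η (t + 1) =
    kernNum τ σ η t / kernDen τ σ η t := by
  have h1 : t + 1 + 2 * η = t + 2 * η + (1 : ℤ) := by push_cast; ring
  have h2 : 2 * η - (t + 1) = 2 * η - t + (-1 : ℤ) := by push_cast; ring
  rw [kernNum_add_one, kernDen, kernDen, h1, h2, wprod_add_int, wprod_add_int]

lemma thetaPair_neg (z μ t : ℂ) : thetaPair τ σ (-z) (-μ) t = thetaPair τ σ z μ (-t) := by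
  have h1 : -z + t = -(z + -t) := by ring
  have h2 : -μ + t = -(μ + -t) := by ring
  rw [thetaPair, h1, h2, theta_neg, theta_neg, neg_mul_neg, thetaPair]

lemma integral_kern_neg (η z μ : ℂ) :
    ∫ t in (0 : ℝ)..1, kernNum τ σ η t / kernDen τ σ η t * thetaPair τ σ (-z) (-μ) t =
      ∫ t in (0 : ℝ)..1, kernNum τ σ η t / kernDen τ σ η t * thetaPair τ σ z μ t := by
  rw [← integral_periodic_neg
    (g := fun t => kernNum τ σ η t / kernDen τ σ η t * thetaPair τ σ z μ t)
    (fun t => by rw [kern_add_one, thetaPair_add_one])]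
  simp only [kern_neg, thetaPair_neg]

/-- The resonance relation at `z = 2 η`. -/
lemma integral_kern_resonance (hτ : 0 < τ.im) (hσ : 0 < σ.im) {η : ℂ} (hη : 0 < η.im) (μ : ℂ) :
    ∫ t in (0 : ℝ)..1, kernNum τ σ η t / kernDen τ σ η t *
        (exp (-(Real.pi * I * μ)) * thetaPair τ σ (2 * η) μ t) =
      ∫ t in (0 : ℝ)..1, kernNum τ σ η t / kernDen τ σ η t *
        (exp (Real.pi * I * μ) * thetaPair τ σ (2 * η) (-μ) t) := by
  obtain ⟨c, hc⟩ := exists_theta_eq_mul_thetaProd hτ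
  have hW := differentiable_wprod hτ hσ
  -- At z = 2η the theta function in τ cancels the k = 0 poles of 1/W(t + 2η), and at z = −2η those
  -- of 1/W(2η − t). Up to constants the two integrands then become g(t + σ) and g(t), with `g`
  -- holomorphic on a strip containing both contours.
  set g : ℂ → ℂ := fun t => exp (Real.pi * I * (t - 2 * η)) *
    (wprod τ σ (t - 2 * η + τ) * wprod τ σ (-t - 2 * η + τ + σ)) /
      (wprod τ σ (t + 2 * η) * wprod τ σ (2 * η + σ - t)) * theta (μ + t) σ with hg
  have hgd : DifferentiableOn ℂ g (strip (-(2 * η.im)) (2 * η.im + σ.im)) := by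
    intro t ht
    have n1 : wprod τ σ (t + 2 * η) ≠ 0 :=
      wprod_ne_zero_of_im_pos hτ hσ (by simp; linarith [ht.1])
    have n2 : wprod τ σ (2 * η + σ - t) ≠ 0 :=
      wprod_ne_zero_of_im_pos hτ hσ (by simp; linarith [ht.2])
    have := mul_ne_zero n1 n2
    have hth := differentiable_theta hσ
    refine DifferentiableAt.differentiableWithinAt ?_
    refine DifferentiableAt.mul (DifferentiableAt.fun_div (by fun_prop) (by fun_prop) this) ?_
    exact (hth _).comp t (by fun_prop : DifferentiableAt ℂ (fun t => μ + t) t)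
  have hgper : ∀ t, g (t + 1) = g t := by
    intro t
    have e1 : t + 1 - 2 * η + τ = t - 2 * η + τ + (1 : ℤ) := by push_cast; ring
    have e2 : -(t + 1) - 2 * η + τ + σ = -t - 2 * η + τ + σ + (-1 : ℤ) := by push_cast; ring
    have e3 : t + 1 + 2 * η = t + 2 * η + (1 : ℤ) := by push_cast; ring
    have e4 : 2 * η + σ - (t + 1) = 2 * η + σ - t + (-1 : ℤ) := by push_cast; ring
    have e5 : exp (Real.pi * I * (t + 1 - 2 * η)) = -exp (Real.pi * I * (t - 2 * η)) := by
      rw [show Real.pi * I * (t + 1 - 2 * η) = Real.pi * I * (t - 2 * η) + Real.pi * I by ring,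
        exp_add, exp_pi_mul_I]
      ring
    simp only [hg]
    rw [e1, e2, e3, e4, e5, wprod_add_int, wprod_add_int, wprod_add_int, wprod_add_int,
      ← add_assoc, theta_add_one]
    ring
  have hshift := integral_periodic_eq_of_mem_strip hgd hgper (v := σ) (w := 0)
    ⟨by linarith, by linarith⟩ ⟨by simp; linarith, by simp; linarith⟩
  have hleft : ∀ t : ℝ, kernNum τ σ η t / kernDen τ σ η t *
      (exp (-(Real.pi * I * μ)) * thetaPair τ σ (2 * η) μ t) =
      -(c * exp (Real.pi * I * μ)) * g (t + σ) := by
    intro t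
    have n1 : wprod τ σ (t + 2 * η) ≠ 0 := wprod_ne_zero_of_im_pos hτ hσ (by simpa using hη)
    have n2 : wprod τ σ (2 * η - t) ≠ 0 := wprod_ne_zero_of_im_pos hτ hσ (by simpa using hη)
    rw [wprod_eq_right hτ hσ] at n1
    have m1 := left_ne_zero_of_mul n1
    have m2 := right_ne_zero_of_mul n1
    have e1 : (t : ℂ) + σ - 2 * η + τ = t - 2 * η + τ + σ := by ring
    have e2 : -((t : ℂ) + σ) - 2 * η + τ + σ = -t - 2 * η + τ := by ring
    have e3 : (t : ℂ) + σ + 2 * η = t + 2 * η + σ := by ring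
    have e4 : 2 * η + σ - ((t : ℂ) + σ) = 2 * η - t := by ring
    have e5 : 2 * η + (t : ℂ) = t + 2 * η := by ring
    have e6 : τ - ((t : ℂ) + 2 * η) = -t - 2 * η + τ := by ring
    have hth : theta (μ + (t + σ)) σ =
        exp (Real.pi * I * (-1 - σ - 2 * (μ + t))) * theta (μ + t) σ := by
      have := theta_add (μ + t) σ 0 1
      simp only [Int.cast_zero, add_zero, Int.cast_one, one_mul, one_pow, mul_one, zero_sub] at this
      rw [← add_assoc, this]
    have hexp : exp (-(Real.pi * I * μ)) * exp (-(Real.pi * I * (t + 2 * η))) =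
        -(exp (Real.pi * I * μ) * exp (Real.pi * I * (t + σ - 2 * η)) *
          exp (Real.pi * I * (-1 - σ - 2 * (μ + t)))) := by
      rw [← exp_add, ← exp_add, ← exp_add]
      have : Real.pi * I * μ + Real.pi * I * (t + σ - 2 * η) +
          Real.pi * I * (-1 - σ - 2 * (μ + t)) =
          -(Real.pi * I * μ) + -(Real.pi * I * (t + 2 * η)) - Real.pi * I := by ring
      rw [this, exp_sub, exp_pi_mul_I, div_neg, div_one, neg_neg]
    simp only [hg, kernNum, kernDen, thetaPair]
    rw [e1, e2, e3, e4, hth, e5, hc (t + 2 * η), thetaProd, e6, wprod_eq_right hτ hσ (t + 2 * η),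
      wprod_eq_right hτ hσ (-t - 2 * η + τ)]
    generalize exp (-(Real.pi * I * μ)) = E₁ at hexp ⊢
    generalize exp (-(Real.pi * I * (t + 2 * η))) = E₂ at hexp ⊢
    generalize exp (Real.pi * I * μ) = E₃ at hexp ⊢
    generalize exp (Real.pi * I * (t + σ - 2 * η)) = E₄ at hexp ⊢
    generalize exp (Real.pi * I * (-1 - σ - 2 * (μ + t))) = E₅ at hexp ⊢
    field_simp
    linear_combination (wprod τ σ (t - 2 * η + τ + σ) * wprod τ σ (-t - 2 * η + τ + σ) *
      c * xprod τ (-t - 2 * η + τ) * theta (μ + t) σ) * hexp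
  have hright : ∀ t : ℝ, kernNum τ σ η t / kernDen τ σ η t * thetaPair τ σ (-(2 * η)) μ t =
      -c * g t := by
    intro t
    have n1 : wprod τ σ (t + 2 * η) ≠ 0 := wprod_ne_zero_of_im_pos hτ hσ (by simpa using hη)
    have n2 : wprod τ σ (2 * η - t) ≠ 0 := wprod_ne_zero_of_im_pos hτ hσ (by simpa using hη)
    rw [wprod_eq_right hτ hσ] at n2
    have m1 := left_ne_zero_of_mul n2
    have m2 := right_ne_zero_of_mul n2
    have e1 : 2 * η + σ - (t : ℂ) = 2 * η - t + σ := by ring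
    have e2 : -(2 * η) + (t : ℂ) = -(2 * η - t) := by ring
    have e3 : τ - (2 * η - (t : ℂ)) = t - 2 * η + τ := by ring
    have e4 : -(Real.pi * I * (2 * η - t)) = Real.pi * I * (t - 2 * η) := by ring
    simp only [hg, kernNum, kernDen, thetaPair]
    rw [e1, e2, theta_neg, hc (2 * η - t), thetaProd, e3, e4, wprod_eq_right hτ hσ (2 * η - t),
      wprod_eq_right hτ hσ (t - 2 * η + τ)]
    field_simp
  -- The reflection t ↦ −t trades (2η, −μ) for (−2η, μ), the case treated in `hright`.
  have h3 := integral_kern_neg (τ := τ) (σ := σ) η (-(2 * η)) μ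
  rw [neg_neg] at h3
  simp only [mul_left_comm _ (exp (Real.pi * I * μ))]
  rw [intervalIntegral.integral_const_mul, h3]
  simp_rw [hleft, hright, intervalIntegral.integral_const_mul]
  simp only [add_zero] at hshift
  rw [hshift]
  ring

end

/-! ### The kernel of the integral operator at a fixed value of `η` -/

/-- The integral of a weight `f` against the theta factors over a horizontal contour. -/
def thetaInt (τ σ : ℂ) (f : ℝ → ℂ) (v z μ : ℂ) : ℂ :=
  ∫ t in (0 : ℝ)..1, f t * thetaPair τ σ z μ (t + v)

section

variable {τ σ : ℂ}

lemma differentiable_thetaInt_left (hτ : 0 < τ.im) (hσ : 0 < σ.im) {f : ℝ → ℂ} (hf : Continuous f)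
    (v μ : ℂ) : Differentiable ℂ fun z => thetaInt τ σ f v z μ := by
  have h1 := differentiable_theta hτ
  have h2 := (differentiable_theta hσ).continuous
  have h1' := h1.continuous
  rw [← differentiableOn_univ]
  refine differentiableOn_intervalIntegral isOpen_univ (Continuous.continuousOn ?_) fun t _ => ?_
  · unfold Function.uncurry thetaPair
    fun_prop
  · exact (((h1.comp (differentiable_id.add_const ((t : ℂ) + v))).mul_const _).const_mul
      _).differentiableOn

lemma differentiable_thetaInt_right (hτ : 0 < τ.im) (hσ : 0 < σ.im) {f : ℝ → ℂ}
    (hf : Continuous f) (v z : ℂ) : Differentiable ℂ (thetaInt τ σ f v z) := by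
  have h1 := (differentiable_theta hτ).continuous
  have h2 := differentiable_theta hσ
  have h2' := h2.continuous
  rw [← differentiableOn_univ]
  refine differentiableOn_intervalIntegral isOpen_univ (Continuous.continuousOn ?_) fun t _ => ?_
  · unfold Function.uncurry thetaPair
    fun_prop
  · exact (((h2.comp (differentiable_id.add_const ((t : ℂ) + v))).const_mul _).const_mul
      _).differentiableOn

lemma thetaPair_shift (z μ t : ℂ) (r s : ℤ) :
    thetaPair τ σ (z + r + s * τ) (μ - r - s * σ) t =
      exp (Real.pi * I * (-(s ^ 2 * τ) - 2 * s * z - s ^ 2 * σ + 2 * s * μ)) *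
        thetaPair τ σ z μ t := by
  have h1 := theta_add (z + t) τ r s
  have h2 := theta_add (μ + t) σ (-r) (-s)
  rw [show z + t + r + s * τ = z + r + s * τ + t by ring] at h1
  rw [show μ + t + ((-r : ℤ) : ℂ) + ((-s : ℤ) : ℂ) * σ = μ - r - s * σ + t by push_cast; ring] at h2
  rw [thetaPair, thetaPair, h1, h2, mul_mul_mul_comm, ← exp_add]
  congr 2
  push_cast
  ring

lemma thetaInt_shift (f : ℝ → ℂ) (v z μ : ℂ) (r s : ℤ) :
    thetaInt τ σ f v (z + r + s * τ) (μ - r - s * σ) =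
      exp (Real.pi * I * (-(s ^ 2 * τ) - 2 * s * z - s ^ 2 * σ + 2 * s * μ)) *
        thetaInt τ σ f v z μ := by
  simp_rw [thetaInt, thetaPair_shift, mul_left_comm (f _), intervalIntegral.integral_const_mul]

lemma exists_bound_thetaInt (hτ : 0 < τ.im) (hσ : 0 < σ.im) {f : ℝ → ℂ} (hf : Continuous f)
    (v : ℂ) (B : ℝ) : ∃ C b : ℝ, 0 ≤ C ∧ 0 ≤ b ∧ ∀ z : ℂ, ‖z‖ ≤ B → ∀ μ : ℂ,
      ‖thetaInt τ σ f v z μ‖ ≤ C * Real.exp (Real.pi * μ.im ^ 2 / σ.im + b * |μ.im|) := by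
  obtain ⟨C₁, hC₁⟩ := (isCompact_Icc (a := (0 : ℝ)) (b := 1)).exists_bound_of_continuousOn
    hf.continuousOn
  obtain ⟨C₂, hC₂⟩ := (isCompact_closedBall (0 : ℂ) (B + (1 + ‖v‖))).exists_bound_of_continuousOn
    (differentiable_theta hτ).continuous.continuousOn
  obtain ⟨C₃, hC₃, hbd⟩ := exists_bound_of_quasiperiodic (differentiable_theta hσ).continuous hσ 2
    (theta_mem_Theta hσ).2
  have hpi := Real.pi_pos
  -- Expanding (Im μ + Im v)² in the level 2 bound for θ(μ + t + v, σ): the square of Im v goes into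
  -- the constant and the cross term gives b.
  refine ⟨|C₁| * (|C₂| * (C₃ * Real.exp (Real.pi * v.im ^ 2 / σ.im))),
    2 * Real.pi * |v.im| / σ.im, by positivity, by positivity, fun z hz μ => ?_⟩
  have key : ∀ t ∈ Set.uIoc (0 : ℝ) 1, ‖f t * thetaPair τ σ z μ (t + v)‖ ≤
      |C₁| * (|C₂| * (C₃ * Real.exp (Real.pi * v.im ^ 2 / σ.im))) *
        Real.exp (Real.pi * μ.im ^ 2 / σ.im + 2 * Real.pi * |v.im| / σ.im * |μ.im|) := by
    intro t ht
    rw [Set.uIoc_of_le zero_le_one] at ht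
    have ht' := Set.Ioc_subset_Icc_self ht
    have h1 : ‖f t‖ ≤ |C₁| := (hC₁ t ht').trans (le_abs_self _)
    have h2 : ‖theta (z + (t + v)) τ‖ ≤ |C₂| := by
      refine (hC₂ _ ?_).trans (le_abs_self _)
      rw [mem_closedBall_zero_iff]
      refine (norm_add_le _ _).trans (add_le_add hz ((norm_add_le _ _).trans ?_))
      gcongr
      rw [norm_real, Real.norm_eq_abs, abs_of_nonneg ht'.1]
      exact ht'.2
    have h3 : ‖theta (μ + (t + v)) σ‖ ≤ C₃ * (Real.exp (Real.pi * v.im ^ 2 / σ.im) *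
        Real.exp (Real.pi * μ.im ^ 2 / σ.im + 2 * Real.pi * |v.im| / σ.im * |μ.im|)) := by
      refine (hbd _).trans ?_
      rw [← Real.exp_add]
      gcongr
      have hab : v.im * μ.im ≤ |v.im| * |μ.im| := by
        rw [← abs_mul]
        exact le_abs_self _
      have him : (μ + (t + v)).im = μ.im + v.im := by simp
      rw [him]
      have : Real.pi * v.im ^ 2 / σ.im +
          (Real.pi * μ.im ^ 2 / σ.im + 2 * Real.pi * |v.im| / σ.im * |μ.im|) -
          Real.pi * ((2 : ℤ) : ℝ) * (μ.im + v.im) ^ 2 / (2 * σ.im) =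
          2 * Real.pi / σ.im * (|v.im| * |μ.im| - v.im * μ.im) := by
        push_cast
        field_simp
        ring
      have h0 : 0 ≤ 2 * Real.pi / σ.im * (|v.im| * |μ.im| - v.im * μ.im) :=
        mul_nonneg (by positivity) (sub_nonneg.2 hab)
      linarith
    rw [norm_mul, thetaPair, norm_mul]
    calc _ ≤ |C₁| * (|C₂| * (C₃ * (Real.exp (Real.pi * v.im ^ 2 / σ.im) *
        Real.exp (Real.pi * μ.im ^ 2 / σ.im + 2 * Real.pi * |v.im| / σ.im * |μ.im|)))) := by gcongr
      _ = _ := by ring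
  have := intervalIntegral.norm_integral_le_of_norm_le_const key
  simpa [thetaInt] using this

end

/-- The properties of the function `Φ` such that `u = exp (-π i z μ / (2 η)) Φ`, for fixed `η`. -/
structure IsKernel (τ σ η : ℂ) (Φ : ℂ → ℂ → ℂ) : Prop where
  u_eq : ∀ z μ, u z μ τ σ η = exp (-(Real.pi * I * z * μ / (2 * η))) * Φ z μ
  differentiable_left : ∀ μ, Differentiable ℂ fun z => Φ z μ
  differentiable_right : ∀ z, Differentiable ℂ (Φ z)
  bound : ∀ B : ℝ, ∃ C b : ℝ, 0 ≤ C ∧ 0 ≤ b ∧ ∀ z : ℂ, ‖z‖ ≤ B → ∀ μ : ℂ,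
    ‖Φ z μ‖ ≤ C * Real.exp (Real.pi * μ.im ^ 2 / σ.im + b * |μ.im|)
  shift : ∀ (z μ : ℂ) (r s : ℤ), Φ (z + r + s * τ) (μ - r - s * σ) =
    exp (Real.pi * I * (-(s ^ 2 * τ) - 2 * s * z - s ^ 2 * σ + 2 * s * μ)) * Φ z μ
  neg_neg : ∀ z μ, Φ (-z) (-μ) = Φ z μ
  resonance : ∀ μ, exp (-(Real.pi * I * μ)) * Φ (2 * η) μ = exp (Real.pi * I * μ) * Φ (2 * η) (-μ)

/-- At fixed η the continuation is a sum of two integrals of theta factors against continuous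
weights. Bounds and shifts hold for any such weights; reflection and resonance depend on the kernel
and are transported from Im η > 0. -/
lemma exists_isKernel {τ σ η : ℂ} (hτ : 0 < τ.im) (hσ : 0 < σ.im) (hη : η ∈ regularSet τ σ) :
    ∃ Φ, IsKernel τ σ η Φ := by
  obtain ⟨C, hC⟩ := exists_isContinuation hτ hσ
  set M := level τ σ η
  have hM : η ∈ levelDomain τ σ M := mem_levelDomain_level hτ hσ η
  obtain ⟨A, B, hAB⟩ := exists_isLevel hτ hσ M
  set Y := height τ σ M
  set a : ℝ → ℂ := fun t => A η (t + Y * I)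
  set b : ℝ → ℂ := fun t => B η (t - Y * I)
  have ha : Continuous a := continuous_iff_continuousAt.2 fun t =>
    ContinuousAt.comp (f := fun t : ℝ => (η, (t : ℂ) + Y * I))
      (hAB.left η hM (t + Y * I) (by simp [Y])).continuousAt (by fun_prop)
  have hb : Continuous b := continuous_iff_continuousAt.2 fun t =>
    ContinuousAt.comp (f := fun t : ℝ => (η, (t : ℂ) - Y * I))
      (hAB.right η hM (t - Y * I) (by simp [Y])).continuousAt (by fun_prop)
  have hint : ∀ z μ, contourInt Y A B (fun _ => thetaPair τ σ z μ) η =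
      thetaInt τ σ a (Y * I) z μ + thetaInt τ σ b (-(Y * I)) z μ := fun z μ => by
    simp [contourInt, thetaInt, a, b, sub_eq_add_neg]
  have hconst : ∀ z μ, Differentiable ℂ (Function.uncurry fun _ : ℂ => thetaPair τ σ z μ) :=
    fun z μ => (differentiable_thetaPair hτ hσ z μ).comp differentiable_snd
  refine ⟨fun z μ => C / polar τ σ M η *
    (thetaInt τ σ a (Y * I) z μ + thetaInt τ σ b (-(Y * I)) z μ),
    fun z μ => ?_, fun μ => ?_, fun z => ?_, fun R => ?_, fun z μ r s => ?_, fun z μ => ?_,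
    fun μ => ?_⟩
  · obtain ⟨F, hF, hform⟩ := hC z μ
    rw [HypTheta.u_eq hτ hσ hF hη, hform M A B hAB η hM hη, hint]
    ring
  · exact ((differentiable_thetaInt_left hτ hσ ha _ μ).add
      (differentiable_thetaInt_left hτ hσ hb _ μ)).const_mul _
  · exact ((differentiable_thetaInt_right hτ hσ ha _ z).add
      (differentiable_thetaInt_right hτ hσ hb _ z)).const_mul _
  · obtain ⟨C₁, b₁, hC₁, hb₁, h₁⟩ := exists_bound_thetaInt hτ hσ ha (Y * I) R
    obtain ⟨C₂, b₂, hC₂, hb₂, h₂⟩ := exists_bound_thetaInt hτ hσ hb (-(Y * I)) R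
    refine ⟨‖C / polar τ σ M η‖ * (C₁ + C₂), b₁ + b₂, by positivity, by positivity,
      fun z hz μ => ?_⟩
    have e1 : C₁ * Real.exp (Real.pi * μ.im ^ 2 / σ.im + b₁ * |μ.im|) ≤
        C₁ * Real.exp (Real.pi * μ.im ^ 2 / σ.im + (b₁ + b₂) * |μ.im|) := by
      gcongr; linarith
    have e2 : C₂ * Real.exp (Real.pi * μ.im ^ 2 / σ.im + b₂ * |μ.im|) ≤
        C₂ * Real.exp (Real.pi * μ.im ^ 2 / σ.im + (b₁ + b₂) * |μ.im|) := by
      gcongr; linarith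
    rw [norm_mul, mul_assoc, add_mul]
    gcongr
    exact (norm_add_le _ _).trans (add_le_add ((h₁ z hz μ).trans e1) ((h₂ z hz μ).trans e2))
  · simp only [thetaInt_shift]
    ring
  · have := hAB.contourInt_congr hτ hσ (hconst (-z) (-μ)) (hconst z μ)
      (fun _ => thetaPair_add_one _ _) (fun _ => thetaPair_add_one _ _)
      (fun η _ => integral_kern_neg η z μ) hM
    rw [hint, hint] at this
    simp only [this]
  -- In the resonance z = 2η moves with η, so the identity theorem is applied with an η-dependent
  -- theta factor. This is why `H` has η as an argument.
  · have hH : ∀ ν : ℂ, Differentiable ℂ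
        (Function.uncurry fun η t : ℂ => thetaPair τ σ (2 * η) ν t) := fun ν => by
      have h1 := differentiable_theta hτ
      have h2 := differentiable_theta hσ
      exact (h1.comp (by fun_prop : Differentiable ℂ fun x : ℂ × ℂ => 2 * x.1 + x.2)).mul
        (h2.comp (by fun_prop : Differentiable ℂ fun x : ℂ × ℂ => ν + x.2))
    have hmul : ∀ e ν : ℂ, contourInt Y A B (fun η t => e * thetaPair τ σ (2 * η) ν t) η =
        e * (thetaInt τ σ a (Y * I) (2 * η) ν + thetaInt τ σ b (-(Y * I)) (2 * η) ν) := by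
      intro e ν
      rw [← hint]
      simp only [contourInt, mul_left_comm _ e, intervalIntegral.integral_const_mul, mul_add]
    have := hAB.contourInt_congr hτ hσ
      (H := fun η t => exp (-(Real.pi * I * μ)) * thetaPair τ σ (2 * η) μ t)
      (H' := fun η t => exp (Real.pi * I * μ) * thetaPair τ σ (2 * η) (-μ) t)
      ((hH μ).const_mul _) ((hH (-μ)).const_mul _) (fun _ _ => by rw [thetaPair_add_one])
      (fun _ _ => by rw [thetaPair_add_one])
      (fun η hη => integral_kern_resonance hτ hσ hη μ) hM
    rw [hmul, hmul] at this
    simp only [mul_left_comm _ (C / _), this]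

/-! ### Division of theta functions by the weight `Q` -/

lemma thetaProd_neg {τ : ℂ} (hτ : 0 < τ.im) (z : ℂ) : thetaProd τ (-z) = -thetaProd τ z := by
  have h : exp (Real.pi * I * z) * (qexp z)⁻¹ = exp (-(Real.pi * I * z)) := by
    rw [← qexp_neg, qexp, ← exp_add]
    ring_nf
  rw [thetaProd_eq hτ, thetaProd_eq hτ, ← h, qexp_neg, show -(Real.pi * I * -z) = Real.pi * I * z by
    ring, show -z + τ = τ - z by ring, show τ - -z = z + τ by ring]
  have := qexp_ne_zero z
  field_simp
  ring

/-- The product of theta functions in the denominator of `Q`, up to a constant. -/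
def weightDen (σ η μ : ℂ) : ℂ := thetaProd σ (μ - 2 * η) * thetaProd σ (μ + 2 * η)

section

variable {σ η : ℂ}

lemma differentiable_weightDen (hσ : 0 < σ.im) : Differentiable ℂ (weightDen σ η) := by
  have := differentiable_thetaProd hσ
  unfold weightDen
  fun_prop

lemma weightDen_neg (hσ : 0 < σ.im) (μ : ℂ) : weightDen σ η (-μ) = weightDen σ η μ := by
  rw [weightDen, weightDen, show -μ - 2 * η = -(μ + 2 * η) by ring,
    show -μ + 2 * η = -(μ - 2 * η) by ring, thetaProd_neg hσ, thetaProd_neg hσ]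
  ring

lemma weightDen_shift (hσ : 0 < σ.im) (r s : ℤ) (μ : ℂ) :
    weightDen σ η (μ + 2 * r + 2 * s * σ) =
      exp (-(2 * Real.pi * I * 4 * (s ^ 2 * σ + s * μ))) * weightDen σ η μ := by
  have h : ∀ w : ℂ, thetaProd σ (w + 2 * r + 2 * s * σ) =
      exp (-(4 * Real.pi * I * (s ^ 2 * σ + s * w))) * thetaProd σ w := by
    intro w
    have h1 := thetaProd_add hσ w (2 * r) (2 * s)
    push_cast at h1
    rw [h1, show Real.pi * I * (2 * r - 2 * s - (2 * s) ^ 2 * σ - 2 * (2 * s) * w) =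
      -(4 * Real.pi * I * (s ^ 2 * σ + s * w)) + Real.pi * I * (2 * ((r - s : ℤ) : ℂ)) by
        push_cast; ring, exp_add, exp_pi_int_mul_two, mul_one]
  rw [weightDen, weightDen,
    show μ + 2 * r + 2 * s * σ - 2 * η = μ - 2 * η + 2 * r + 2 * s * σ by ring,
    show μ + 2 * r + 2 * s * σ + 2 * η = μ + 2 * η + 2 * r + 2 * s * σ by ring, h, h,
    mul_mul_mul_comm, ← exp_add]
  congr 2
  ring

lemma exists_of_weightDen_eq_zero (hσ : 0 < σ.im) {μ : ℂ} (h : weightDen σ η μ = 0) :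
    ∃ r s : ℤ, μ = 2 * η + r + s * σ ∨ μ = -(2 * η) + r + s * σ := by
  rcases mul_eq_zero.1 h with h | h
  · obtain ⟨r, s, hrs⟩ := exists_of_thetaProd_eq_zero hσ h
    exact ⟨r, s, .inl (by linear_combination hrs)⟩
  · obtain ⟨r, s, hrs⟩ := exists_of_thetaProd_eq_zero hσ h
    exact ⟨r, s, .inr (by linear_combination hrs)⟩

lemma countable_weightDen_eq_zero (hσ : 0 < σ.im) : {μ | weightDen σ η μ = 0}.Countable := by
  refine (((countable_lattice σ).image fun w => 2 * η + w).union
    ((countable_lattice σ).image fun w => -(2 * η) + w)).mono fun μ hμ => ?_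
  obtain ⟨r, s, h | h⟩ := exists_of_weightDen_eq_zero hσ hμ
  · exact .inl ⟨r + s * σ, ⟨r, s, rfl⟩, by rw [h]; ring⟩
  · exact .inr ⟨r + s * σ, ⟨r, s, rfl⟩, by rw [h]; ring⟩

lemma deriv_weightDen_ne_zero (hσ : 0 < σ.im) (hne : theta (4 * η) σ ≠ 0) {μ : ℂ}
    (h : weightDen σ η μ = 0) : deriv (weightDen σ η) μ ≠ 0 := by
  have hd := differentiable_thetaProd hσ
  have h1 : HasDerivAt (fun μ => thetaProd σ (μ - 2 * η)) (deriv (thetaProd σ) (μ - 2 * η)) μ :=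
    (hd _).hasDerivAt.comp_sub_const μ (2 * η)
  have h2 : HasDerivAt (fun μ => thetaProd σ (μ + 2 * η)) (deriv (thetaProd σ) (μ + 2 * η)) μ :=
    (hd _).hasDerivAt.comp_add_const μ (2 * η)
  have h3 : deriv (weightDen σ η) μ = deriv (thetaProd σ) (μ - 2 * η) * thetaProd σ (μ + 2 * η) +
      thetaProd σ (μ - 2 * η) * deriv (thetaProd σ) (μ + 2 * η) := (h1.mul h2).deriv
  -- A common zero would put 4η in the lattice, contradicting θ(4η, σ) ≠ 0; hence the zeros are
  -- simple.
  have hboth : ¬(thetaProd σ (μ - 2 * η) = 0 ∧ thetaProd σ (μ + 2 * η) = 0) := by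
    rintro ⟨h1, h2⟩
    obtain ⟨r, s, hrs⟩ := exists_of_thetaProd_eq_zero hσ h1
    obtain ⟨r', s', hrs'⟩ := exists_of_thetaProd_eq_zero hσ h2
    apply hne
    have : 4 * η = ((r' - r : ℤ) : ℂ) + ((s' - s : ℤ) : ℂ) * σ := by
      push_cast
      linear_combination hrs' - hrs
    rw [this, theta_lattice]
  rw [h3]
  rcases mul_eq_zero.1 h with h | h
  · rw [h, zero_mul, add_zero]
    exact mul_ne_zero (deriv_thetaProd_ne_zero hσ h) fun h' => hboth ⟨h, h'⟩
  · rw [h, mul_zero, zero_add]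
    exact mul_ne_zero (fun h' => hboth ⟨h', h⟩) (deriv_thetaProd_ne_zero hσ h)

lemma exists_Q_eq (hσ : 0 < σ.im) :
    ∃ K : ℂ, (theta (4 * η) σ = 0 → K = 0) ∧ ∀ μ, Q μ σ η = K / weightDen σ η μ := by
  obtain ⟨d, hd⟩ := exists_theta_eq_mul_thetaProd hσ
  refine ⟨theta (4 * η) σ * deriv (fun x => theta x σ) 0 * (d⁻¹ * d⁻¹), fun h => by simp [h],
    fun μ => ?_⟩
  rw [Q, hd (μ - 2 * η), hd (μ + 2 * η), weightDen]
  simp only [div_eq_mul_inv, mul_inv]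
  ring

/-- For `f ∈ E κ σ η` the function `μ ↦ Q μ f (-μ)` is an odd theta function of level `κ - 2`. -/
lemma exists_entire_Q_mul (hσ : 0 < σ.im) (hη : η ≠ 0) {κ : ℤ} {f : ℂ → ℂ} (hf : f ∈ E κ σ η) :
    ∃ h ∈ Theta (κ - 2) σ, (∀ μ, h (-μ) = -h μ) ∧
      ∀ᵐ x : ℝ, Q (η * x) σ η * f (-(η * x)) = h (η * x) := by
  obtain ⟨K, hK0, hK⟩ := exists_Q_eq (η := η) hσ
  -- If θ(4η, σ) = 0 the zeros of the denominator need not be simple, but then `Q` is identically 0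
  -- and h = 0 works.
  by_cases h4 : theta (4 * η) σ = 0
  · refine ⟨0, Submodule.zero_mem _, by simp, .of_forall fun x => ?_⟩
    simp [hK, hK0 h4]
  obtain ⟨⟨hfd, hfq⟩, hfo, hfv⟩ := hf
  have hcont := countable_weightDen_eq_zero (η := η) hσ
  have hdense := dense_ne_zero_of_countable hcont
  have hfg : ∀ μ, weightDen σ η μ = 0 → f (-μ) = 0 := by
    intro μ hμ
    rw [hfo, neg_eq_zero]
    obtain ⟨r, s, h | h⟩ := exists_of_weightDen_eq_zero hσ hμ
    · have := hfv 1 (by norm_num) le_rfl r s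
      rw [h, ← this]
      push_cast
      ring_nf
    · have := hfv (-1) le_rfl (by norm_num) r s
      rw [h, ← this]
      push_cast
      ring_nf
  set q := entireQuot (fun μ => f (-μ)) (weightDen σ η) with hq
  have hqd : Differentiable ℂ q := differentiable_entireQuot (hfd.comp differentiable_neg)
    (differentiable_weightDen hσ) hfg fun μ => deriv_weightDen_ne_zero hσ h4
  have hqc := hqd.continuous
  -- Levels subtract: κ + 2 for `f`, 4 for the denominator.
  have hqq : ∀ (r s : ℤ) (z : ℂ), q (z + 2 * r + 2 * s * σ) =
      exp (-(2 * Real.pi * I * (κ - 2 : ℤ) * ((s : ℂ) ^ 2 * σ + s * z))) * q z := by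
    intro r s
    refine congr_fun (Continuous.ext_on hdense (by fun_prop) (by fun_prop) fun z hz => ?_)
    have h1 := weightDen_shift (η := η) hσ r s z
    have h2 := hfq (-r) (-s) (-z)
    rw [show -z + 2 * ((-r : ℤ) : ℂ) + 2 * ((-s : ℤ) : ℂ) * σ = -(z + 2 * r + 2 * s * σ) by
      push_cast; ring] at h2
    have hz' : weightDen σ η (z + 2 * r + 2 * s * σ) ≠ 0 := by
      rw [h1]
      exact mul_ne_zero (exp_ne_zero _) hz
    simp only [hq]
    rw [entireQuot_eq_of_ne hz', entireQuot_eq_of_ne hz, h1, h2, mul_div_mul_comm, ← exp_sub]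
    congr 2
    push_cast
    ring
  have hqo : ∀ z, q (-z) = -q z := by
    refine congr_fun (Continuous.ext_on hdense (by fun_prop) (by fun_prop) fun z hz => ?_)
    have hz' : weightDen σ η (-z) ≠ 0 := by rwa [weightDen_neg hσ]
    simp only [hq]
    rw [entireQuot_eq_of_ne hz', entireQuot_eq_of_ne hz, weightDen_neg hσ, hfo (-z), neg_div]
  refine ⟨K • q, Submodule.smul_mem _ _ ⟨hqd, hqq⟩, fun z => by simp [hqo], ?_⟩
  -- At zeros of the denominator `Q` has the default value 0, which may differ from the removed
  -- singularity; this happens for countably many x only.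
  have hcount : {x : ℝ | weightDen σ η (η * x) = 0}.Countable :=
    hcont.preimage (f := fun x : ℝ => η * (x : ℂ)) fun x y hxy => by
      simpa [hη] using hxy
  filter_upwards [hcount.ae_notMem (volume : Measure ℝ)] with x hx
  rw [hK, Pi.smul_apply, smul_eq_mul, hq, entireQuot_eq_of_ne hx]
  ring

end

/-! ### The integral operator -/

/-- The integrand of the operator `T`, up to a constant. -/
def gaussKernel (η : ℂ) (Φ : ℂ → ℂ → ℂ) (h : ℂ → ℂ) (z μ : ℂ) : ℂ :=
  exp (-(Real.pi * I * (z + μ) ^ 2 / (4 * η))) * (Φ z μ * h μ)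

section

variable {τ η : ℂ} {κ : ℤ} {Φ : ℂ → ℂ → ℂ} {h : ℂ → ℂ}

lemma mul_abs_le_sq (b x : ℝ) {c : ℝ} (hc : 0 < c) : b * |x| ≤ c / 2 * x ^ 2 + b ^ 2 / (2 * c) := by
  have h1 : 0 ≤ (c * |x| - b) ^ 2 / (2 * c) := by positivity
  have h2 : (c * |x| - b) ^ 2 / (2 * c) = c / 2 * x ^ 2 - b * |x| + b ^ 2 / (2 * c) := by
    rw [← sq_abs x]
    field_simp
    ring
  linarith

lemma re_gauss_le (hη : η.im < 0) (ζ : ℂ) (x : ℝ) :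
    (-(Real.pi * I * (ζ + η * x) ^ 2 / (4 * η))).re ≤
      Real.pi * ‖ζ‖ ^ 2 / (4 * ‖η‖) + Real.pi * ‖ζ‖ / 2 * |x| + Real.pi * η.im * x ^ 2 / 4 := by
  have hη0 : η ≠ 0 := by rintro rfl; simp at hη
  have hpi := Real.pi_pos
  have he : -(Real.pi * I * (ζ + η * x) ^ 2 / (4 * η)) =
      -(Real.pi * I * ζ ^ 2 / (4 * η)) + -(Real.pi * I * ζ / 2 * x) +
        ((Real.pi * x ^ 2 / 4 : ℝ) : ℂ) * -(I * η) := by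
    push_cast
    field_simp
    ring
  have h1 : (-(Real.pi * I * ζ ^ 2 / (4 * η))).re ≤ Real.pi * ‖ζ‖ ^ 2 / (4 * ‖η‖) := by
    refine (re_le_norm _).trans (le_of_eq ?_)
    simp [abs_of_pos hpi]
  have h2 : (-(Real.pi * I * ζ / 2 * x)).re ≤ Real.pi * ‖ζ‖ / 2 * |x| := by
    refine (re_le_norm _).trans (le_of_eq ?_)
    simp [abs_of_pos hpi]
  have h3 : (((Real.pi * x ^ 2 / 4 : ℝ) : ℂ) * -(I * η)).re = Real.pi * η.im * x ^ 2 / 4 := by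
    rw [re_ofReal_mul]
    simp
    ring
  rw [he, add_re, add_re, h3]
  linarith

/-- The Gaussian decay of the integrand along the lines parallel to `η ℝ`. -/
lemma exists_bound_gaussKernel (hτ : 0 < τ.im) (hη : η.im < 0) (hκ : 0 ≤ κ)
    (hΦ : IsKernel τ (τ - 2 * η * κ) η Φ) (hh : h ∈ Theta (κ - 2) (τ - 2 * η * κ)) (B : ℝ) :
    ∃ C c : ℝ, 0 < c ∧ ∀ z : ℂ, ‖z‖ ≤ B → ∀ w : ℂ, ‖w‖ ≤ B → ∀ x : ℝ,
      ‖gaussKernel η Φ h z (η * (x + w))‖ ≤ C * Real.exp (-c * x ^ 2) := by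
  set σ := τ - 2 * η * κ with hσdef
  have hκ' : (0 : ℝ) ≤ κ := by exact_mod_cast hκ
  have hσim : σ.im = τ.im + 2 * κ * -η.im := by
    rw [hσdef]
    simp
    ring
  have hσ : 0 < σ.im := by
    rw [hσim]
    have : 0 ≤ 2 * (κ : ℝ) * -η.im := mul_nonneg (by positivity) (by linarith)
    linarith
  have hpi := Real.pi_pos
  obtain ⟨C₁, b, hC₁, hb, hΦb⟩ := hΦ.bound B
  obtain ⟨C₂, hC₂, hhb⟩ := exists_bound_of_quasiperiodic hh.1.continuous hσ (κ - 2) hh.2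
  set e := -η.im with he
  have he0 : 0 < e := by rw [he]; linarith
  -- `D` bounds ‖ηw‖ and `Z` bounds ‖z + ηw‖. The exponent will be at most c' + b'|x| − c₀x², and
  -- half of c₀ absorbs the linear term.
  set Z := |B| + ‖η‖ * |B|
  set D := ‖η‖ * |B|
  set c₀ := Real.pi * e * τ.im / (4 * σ.im) with hc₀
  have hc₀pos : 0 < c₀ := by positivity
  set b' := Real.pi * Z / 2 + Real.pi * κ * e * D / σ.im + b * e with hb'
  set c' := Real.pi * Z ^ 2 / (4 * ‖η‖) + Real.pi * κ * D ^ 2 / (2 * σ.im) + b * D with hc'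
  refine ⟨C₁ * C₂ * Real.exp (c' + b' ^ 2 / (2 * c₀)), c₀ / 2, by positivity,
    fun z hz w hw x => ?_⟩
  set μ := η * (x + w) with hμ
  have hηw : ‖η * w‖ ≤ D := by
    rw [norm_mul]
    exact mul_le_mul_of_nonneg_left (hw.trans (le_abs_self B)) (norm_nonneg _)
  have hζ : ‖z + η * w‖ ≤ Z :=
    (norm_add_le _ _).trans (add_le_add (hz.trans (le_abs_self B)) hηw)
  have him : |μ.im| ≤ e * |x| + D := by
    have : μ.im = η.im * x + (η * w).im := by
      rw [hμ, mul_add, add_im, im_mul_ofReal]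
    rw [this]
    refine (abs_add_le _ _).trans (add_le_add ?_ ((abs_im_le_norm _).trans hηw))
    rw [abs_mul, abs_of_neg hη]
  have hsq : μ.im ^ 2 ≤ (e * |x| + D) ^ 2 := by
    rw [← sq_abs]
    gcongr
  have hexp1 : (-(Real.pi * I * (z + μ) ^ 2 / (4 * η))).re ≤
      Real.pi * Z ^ 2 / (4 * ‖η‖) + Real.pi * Z / 2 * |x| - Real.pi * e * x ^ 2 / 4 := by
    have h1 := re_gauss_le hη (z + η * w) x
    rw [show z + μ = z + η * w + η * x by rw [hμ]; ring]
    have h2 : Real.pi * ‖z + η * w‖ ^ 2 / (4 * ‖η‖) ≤ Real.pi * Z ^ 2 / (4 * ‖η‖) := by gcongr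
    have h3 : Real.pi * ‖z + η * w‖ / 2 * |x| ≤ Real.pi * Z / 2 * |x| := by gcongr
    have h4 : Real.pi * η.im * x ^ 2 / 4 = -(Real.pi * e * x ^ 2 / 4) := by rw [he]; ring
    linarith
  have hexp2 : Real.pi * κ * μ.im ^ 2 / (2 * σ.im) + b * |μ.im| ≤
      Real.pi * κ * (e * |x| + D) ^ 2 / (2 * σ.im) + b * (e * |x| + D) := by gcongr
  have hexp3 : Real.pi * κ * (e * |x| + D) ^ 2 / (2 * σ.im) - Real.pi * e * x ^ 2 / 4 =
      -c₀ * x ^ 2 + Real.pi * κ * e * D / σ.im * |x| + Real.pi * κ * D ^ 2 / (2 * σ.im) := by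
    -- The choice σ = τ − 2ηκ enters here: the quadratic growth is πe(Im σ − Im τ)x²/(4 Im σ),
    -- against a Gaussian decay of πex²/4.
    have hk : 2 * κ * e = σ.im - τ.im := by rw [hσim]; ring
    have h2 : Real.pi * κ * (e * |x| + D) ^ 2 / (2 * σ.im) =
        Real.pi * e * (2 * κ * e) / (4 * σ.im) * x ^ 2 + Real.pi * κ * e * D / σ.im * |x| +
          Real.pi * κ * D ^ 2 / (2 * σ.im) := by
      rw [← sq_abs x]
      field_simp
      ring
    rw [h2, hk, hc₀]
    field_simp
    ring
  have htotal : (-(Real.pi * I * (z + μ) ^ 2 / (4 * η))).re +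
      (Real.pi * κ * μ.im ^ 2 / (2 * σ.im) + b * |μ.im|) ≤
      c' + b' ^ 2 / (2 * c₀) + -(c₀ / 2) * x ^ 2 := by
    have h1 := mul_abs_le_sq b' x hc₀pos
    have h2 : b' * |x| = Real.pi * Z / 2 * |x| + Real.pi * κ * e * D / σ.im * |x| + b * e * |x| := by
      rw [hb']; ring
    rw [hc']
    linarith
  have hexp : Real.exp (Real.pi * μ.im ^ 2 / σ.im + b * |μ.im|) *
      Real.exp (Real.pi * (κ - 2 : ℤ) * μ.im ^ 2 / (2 * σ.im)) =
      Real.exp (Real.pi * κ * μ.im ^ 2 / (2 * σ.im) + b * |μ.im|) := by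
    rw [← Real.exp_add]
    congr 1
    push_cast
    field_simp
    ring
  rw [gaussKernel, norm_mul, norm_mul, norm_exp]
  calc _ ≤ Real.exp (-(Real.pi * I * (z + μ) ^ 2 / (4 * η))).re *
        ((C₁ * Real.exp (Real.pi * μ.im ^ 2 / σ.im + b * |μ.im|)) *
          (C₂ * Real.exp (Real.pi * (κ - 2 : ℤ) * μ.im ^ 2 / (2 * σ.im)))) := by
        gcongr
        · exact hΦb z hz μ
        · exact hhb μ
    _ = C₁ * C₂ * (Real.exp (-(Real.pi * I * (z + μ) ^ 2 / (4 * η))).re *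
          (Real.exp (Real.pi * μ.im ^ 2 / σ.im + b * |μ.im|) *
            Real.exp (Real.pi * (κ - 2 : ℤ) * μ.im ^ 2 / (2 * σ.im)))) := by ring
    _ = C₁ * C₂ * Real.exp ((-(Real.pi * I * (z + μ) ^ 2 / (4 * η))).re +
          (Real.pi * κ * μ.im ^ 2 / (2 * σ.im) + b * |μ.im|)) := by rw [hexp, ← Real.exp_add]
    _ ≤ C₁ * C₂ * Real.exp (c' + b' ^ 2 / (2 * c₀) + -(c₀ / 2) * x ^ 2) := by gcongr
    _ = _ := by rw [Real.exp_add]; ring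

/-- The integral of `gaussKernel` over `η ℝ`. -/
def gaussInt (η : ℂ) (Φ : ℂ → ℂ → ℂ) (h : ℂ → ℂ) (z : ℂ) : ℂ :=
  ∫ x : ℝ, gaussKernel η Φ h z (η * x)

lemma differentiable_gaussKernel_left {σ : ℂ} (hΦ : IsKernel τ σ η Φ) (μ : ℂ) :
    Differentiable ℂ fun z => gaussKernel η Φ h z μ := by
  have := hΦ.differentiable_left μ
  unfold gaussKernel
  simp only [div_eq_mul_inv]
  fun_prop

lemma differentiable_gaussKernel_right {σ : ℂ} (hΦ : IsKernel τ σ η Φ) (hh : Differentiable ℂ h)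
    (z : ℂ) : Differentiable ℂ (gaussKernel η Φ h z) := by
  have := hΦ.differentiable_right z
  unfold gaussKernel
  simp only [div_eq_mul_inv]
  fun_prop

lemma continuous_gaussKernel {σ : ℂ} (hΦ : IsKernel τ σ η Φ) (hh : Differentiable ℂ h) (z : ℂ) :
    Continuous fun x : ℝ => gaussKernel η Φ h z (η * x) :=
  (differentiable_gaussKernel_right hΦ hh z).continuous.comp (by fun_prop)

lemma integrable_gaussKernel (hτ : 0 < τ.im) (hη : η.im < 0) (hκ : 0 ≤ κ)
    (hΦ : IsKernel τ (τ - 2 * η * κ) η Φ) (hh : h ∈ Theta (κ - 2) (τ - 2 * η * κ)) (z : ℂ) :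
    Integrable fun x : ℝ => gaussKernel η Φ h z (η * x) := by
  obtain ⟨C, c, hc, hb⟩ := exists_bound_gaussKernel hτ hη hκ hΦ hh ‖z‖
  refine ((integrable_exp_neg_mul_sq hc).const_mul C).mono'
    (continuous_gaussKernel hΦ hh.1 z).aestronglyMeasurable (.of_forall fun x => ?_)
  simpa using hb z le_rfl 0 (by simp) x

lemma differentiable_gaussInt (hτ : 0 < τ.im) (hη : η.im < 0) (hκ : 0 ≤ κ)
    (hΦ : IsKernel τ (τ - 2 * η * κ) η Φ) (hh : h ∈ Theta (κ - 2) (τ - 2 * η * κ)) :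
    Differentiable ℂ (gaussInt η Φ h) := by
  rw [← differentiableOn_univ]
  refine differentiableOn_integral isOpen_univ
    (fun z _ => (continuous_gaussKernel hΦ hh.1 z).aestronglyMeasurable)
    (.of_forall fun x => (differentiable_gaussKernel_left hΦ _).differentiableOn) fun z₀ _ => ?_
  obtain ⟨C, c, hc, hb⟩ := exists_bound_gaussKernel hτ hη hκ hΦ hh (‖z₀‖ + 1)
  refine ⟨1, one_pos, _, (integrable_exp_neg_mul_sq hc).const_mul C,
    .of_forall fun x z hz => ?_⟩
  have hz' : ‖z‖ ≤ ‖z₀‖ + 1 := by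
    rw [Metric.mem_ball, dist_eq_norm] at hz
    linarith [norm_sub_norm_le z z₀]
  simpa using hb z hz' 0 (by simp; positivity) x

/-- Translating μ by −v is translating x by the complex number −v/η, which is permitted because the
Gaussian bound is uniform for complex offsets in a ball. -/
lemma gaussInt_eq_shift (hτ : 0 < τ.im) (hη : η.im < 0) (hκ : 0 ≤ κ)
    (hΦ : IsKernel τ (τ - 2 * η * κ) η Φ) (hh : h ∈ Theta (κ - 2) (τ - 2 * η * κ)) (z v : ℂ) :
    gaussInt η Φ h z = ∫ x : ℝ, gaussKernel η Φ h z (η * x - v) := by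
  have hη0 : η ≠ 0 := by rintro rfl; simp at hη
  have := integral_line_eq (g := fun x => gaussKernel η Φ h z (η * x))
    ((differentiable_gaussKernel_right hΦ hh.1 z).comp (differentiable_id.const_mul η))
    (fun w => ?_) (-(v / η))
  · rw [gaussInt, ← this]
    congr 1
    ext x
    congr 1
    field_simp
    ring
  · obtain ⟨C, c, hc, hb⟩ := exists_bound_gaussKernel hτ hη hκ hΦ hh (max ‖z‖ (‖w‖ + 1))
    refine ⟨1, one_pos, _, (integrable_exp_neg_mul_sq hc).const_mul C, fun w' hw' x => ?_⟩
    refine hb z (le_max_left _ _) w' (le_max_of_le_right ?_) x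
    rw [Metric.mem_ball, dist_eq_norm] at hw'
    linarith [norm_sub_norm_le w' w]

lemma gaussInt_neg {σ : ℂ} (hΦ : IsKernel τ σ η Φ) (ho : ∀ μ, h (-μ) = -h μ) (z : ℂ) :
    gaussInt η Φ h (-z) = -gaussInt η Φ h z := by
  rw [gaussInt, ← integral_neg_eq_self, gaussInt, ← integral_neg]
  congr 1
  ext x
  have : η * ((-x : ℝ) : ℂ) = -(η * x) := by push_cast; ring
  rw [this, gaussKernel, gaussKernel, hΦ.neg_neg, ho, ← neg_add, neg_sq]
  ring

/-- After translating the line by 2r + 2sσ, the factors exp(−2πisκμ), exp(4πisμ) and exp(2πi(κ−2)sμ)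
from the Gaussian, Φ and h cancel, so the integrands are proportional. -/
lemma gaussInt_shift (hτ : 0 < τ.im) (hη : η.im < 0) (hκ : 0 ≤ κ)
    (hΦ : IsKernel τ (τ - 2 * η * κ) η Φ) (hh : h ∈ Theta (κ - 2) (τ - 2 * η * κ))
    (r s : ℤ) (z : ℂ) : gaussInt η Φ h (z + 2 * r + 2 * s * τ) =
      exp (-(2 * Real.pi * I * (κ + 2 : ℤ) * ((s : ℂ) ^ 2 * τ + s * z))) * gaussInt η Φ h z := by
  have hη0 : η ≠ 0 := by rintro rfl; simp at hη
  set σ := τ - 2 * η * κ with hσ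
  rw [gaussInt_eq_shift hτ hη hκ hΦ hh _ (2 * r + 2 * s * σ), gaussInt, ← integral_const_mul]
  congr 1
  ext x
  have h1 := hΦ.shift z (η * x) (2 * r) (2 * s)
  have h2 := hh.2 (-r) (-s) (η * x)
  push_cast at h1 h2
  have e1 : η * x - (2 * r + 2 * s * σ) = η * x - 2 * r - 2 * s * σ := by ring
  have e2 : η * x - 2 * r - 2 * s * σ = η * x + 2 * -(r : ℂ) + 2 * -s * σ := by ring
  rw [e1, gaussKernel, h1, e2, h2, gaussKernel]
  generalize Φ z (η * x) = P
  generalize h (η * x) = R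
  rw [show ∀ a b c P R : ℂ, a * (b * P * (c * R)) = a * b * c * (P * R) by intros; ring,
    ← mul_assoc (exp _) (exp _) (P * R), ← exp_add, ← exp_add, ← exp_add]
  congr 2
  rw [hσ]
  push_cast
  field_simp
  ring

/-- Translating the line by r + sσ turns z + μ into μ + 2η(1 + κs). The linear exponentials then
split so that one, exp(−πiμ), makes Φ(2η, μ) even, and the other makes the translate of h odd. -/
lemma gaussInt_resonance (hτ : 0 < τ.im) (hη : η.im < 0) (hκ : 0 ≤ κ)
    (hΦ : IsKernel τ (τ - 2 * η * κ) η Φ) (hh : h ∈ Theta (κ - 2) (τ - 2 * η * κ))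
    (ho : ∀ μ, h (-μ) = -h μ) (r s : ℤ) : gaussInt η Φ h (2 * η + r + s * τ) = 0 := by
  have hη0 : η ≠ 0 := by rintro rfl; simp at hη
  set σ := τ - 2 * η * κ with hσ
  set m : ℂ → ℂ := fun μ => exp (-(Real.pi * I * μ)) * Φ (2 * η) μ with hm
  set n : ℂ → ℂ := fun μ => exp (-(Real.pi * I * (κ - 2) * s * μ)) * h (μ - r - s * σ) with hn
  have hm' : ∀ μ, m (-μ) = m μ := fun μ => by
    simp only [hm]
    rw [hΦ.resonance, mul_neg, neg_neg]
  have hn' : ∀ μ, n (-μ) = -n μ := by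
    intro μ
    have h1 := hh.2 r s (μ - r - s * σ)
    have e1 : -μ - r - s * σ = -(μ + r + s * σ) := by ring
    have e2 : μ - r - s * σ + 2 * r + 2 * s * σ = μ + r + s * σ := by ring
    rw [e2] at h1
    simp only [hn]
    rw [e1, ho, h1, mul_neg, ← mul_assoc, ← exp_add]
    have : -(Real.pi * I * (κ - 2) * s * -μ) + -(2 * Real.pi * I * (κ - 2 : ℤ) *
        ((s : ℂ) ^ 2 * σ + s * (μ - r - s * σ))) = -(Real.pi * I * (κ - 2) * s * μ) +
        Real.pi * I * (2 * (((κ - 2) * s * r : ℤ) : ℂ)) := by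
      push_cast
      ring
    rw [this, exp_add, exp_pi_int_mul_two, mul_one]
  set k : ℂ → ℂ := fun μ => exp (-(Real.pi * I * μ ^ 2 / (4 * η))) * (m μ * n μ) with hk
  have hk' : ∀ μ, k (-μ) = -k μ := fun μ => by
    simp only [hk]
    rw [hm', hn', neg_sq]
    ring
  have hint : ∫ x : ℝ, k (η * x) = 0 := by
    have h1 := integral_neg_eq_self (fun x : ℝ => k (η * x)) volume
    simp only [ofReal_neg, mul_neg, hk', integral_neg] at h1
    exact self_eq_neg.1 h1.symm
  rw [gaussInt_eq_shift hτ hη hκ hΦ hh _ (r + s * σ)]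
  have hker : ∀ x : ℝ, gaussKernel η Φ h (2 * η + r + s * τ) (η * x - (r + s * σ)) =
      exp (-(Real.pi * I * η * (1 + κ * s) ^ 2) + Real.pi * I * (-(s ^ 2 * τ) - 4 * s * η -
        s ^ 2 * σ)) * k (η * x) := by
    intro x
    have h1 := hΦ.shift (2 * η) (η * x) r s
    have e1 : η * x - (r + s * σ) = η * x - r - s * σ := by ring
    rw [e1, gaussKernel, h1]
    simp only [hk, hm, hn]
    generalize Φ (2 * η) (η * x) = P
    generalize h (η * x - r - s * σ) = R
    rw [show ∀ a b P R : ℂ, a * (b * P * R) = a * b * (P * R) by intros; ring,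
      show ∀ a b c d P R : ℂ, a * (b * (c * P * (d * R))) = a * b * c * d * (P * R) by
        intros; ring, ← exp_add, ← exp_add, ← exp_add, ← exp_add]
    congr 2
    rw [hσ]
    field_simp
    ring
  simp_rw [hker]
  rw [integral_const_mul, hint, mul_zero]

/-- A lattice point w = r + sτ equals −w + 2r + 2sτ, and the multiplier at −w is 1. Hence the value
at w equals the value at −w, and oddness makes it 0. -/
lemma gaussInt_lattice (hτ : 0 < τ.im) (hη : η.im < 0) (hκ : 0 ≤ κ)
    (hΦ : IsKernel τ (τ - 2 * η * κ) η Φ) (hh : h ∈ Theta (κ - 2) (τ - 2 * η * κ))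
    (ho : ∀ μ, h (-μ) = -h μ) (r s : ℤ) : gaussInt η Φ h (r + s * τ) = 0 := by
  have h1 := gaussInt_shift hτ hη hκ hΦ hh r s (-(r + s * τ))
  rw [gaussInt_neg hΦ ho] at h1
  have e1 : -(r + s * τ) + 2 * r + 2 * s * τ = r + s * τ := by ring
  have e2 : -(2 * Real.pi * I * (κ + 2 : ℤ) * ((s : ℂ) ^ 2 * τ + s * -(r + s * τ))) =
      Real.pi * I * (2 * (((κ + 2) * s * r : ℤ) : ℂ)) := by
    push_cast
    ring
  rw [e1, e2, exp_pi_int_mul_two, one_mul] at h1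
  exact self_eq_neg.1 h1

lemma gaussInt_mem_E (hτ : 0 < τ.im) (hη : η.im < 0) (hκ : 0 ≤ κ)
    (hΦ : IsKernel τ (τ - 2 * η * κ) η Φ) (hh : h ∈ Theta (κ - 2) (τ - 2 * η * κ))
    (ho : ∀ μ, h (-μ) = -h μ) : gaussInt η Φ h ∈ E κ τ η := by
  refine ⟨⟨differentiable_gaussInt hτ hη hκ hΦ hh, gaussInt_shift hτ hη hκ hΦ hh⟩,
    gaussInt_neg hΦ ho, fun j hj₁ hj₂ r s => ?_⟩
  obtain rfl | rfl | rfl : j = -1 ∨ j = 0 ∨ j = 1 := by omega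
  · have := gaussInt_resonance hτ hη hκ hΦ hh ho (-r) (-s)
    rw [show 2 * η * ((-1 : ℤ) : ℂ) + r + s * τ =
      -(2 * η + ((-r : ℤ) : ℂ) + ((-s : ℤ) : ℂ) * τ) by push_cast; ring, gaussInt_neg hΦ ho, this,
      neg_zero]
  · simpa using gaussInt_lattice hτ hη hκ hΦ hh ho r s
  · simpa using gaussInt_resonance hτ hη hκ hΦ hh ho r s

end

/-! ### Regularity of η, and assembly of the theorem. -/

lemma mem_regularSet {κ : ℤ} (hκ : 4 ≤ κ) {τ η : ℂ} (hτ : 0 < τ.im) (hη : η.im < 0)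
    (hreg : ∀ j : ℕ, 1 ≤ j → ∀ l : ℤ, (j : ℂ) * τ + 4 * η ≠ (l : ℂ)) :
    η ∈ regularSet τ (τ - 2 * η * κ) := by
  intro l m n h
  -- For n = 0 the divisors are excluded by Im η < 0 when m = 0 and by hypothesis when m ≥ 1. For n
  -- ≥ 1 the imaginary part is (m + n) Im τ + (2nκ − 4)(−Im η) > 0.
  rcases Nat.eq_zero_or_pos n with rfl | hn
  · rcases Nat.eq_zero_or_pos m with rfl | hm
    · have := congrArg im h
      simp at this
      linarith
    · refine hreg m hm (-l) ?_
      push_cast at h ⊢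
      linear_combination h
  · have h1 := congrArg im h
    have hκ' : (4 : ℝ) ≤ κ := by exact_mod_cast hκ
    have hn' : (1 : ℝ) ≤ n := by exact_mod_cast hn
    have h2 : 0 ≤ (m : ℝ) * τ.im := by positivity
    have h3 : 0 < (n : ℝ) * τ.im := by positivity
    have h4 : 4 ≤ (n : ℝ) * κ := by nlinarith
    simp at h1
    nlinarith

end HypTheta

end

theorem proposition2p3 (κ : ℤ) (hκ : 4 ≤ κ) (τ η : ℂ) (hτ : 0 < τ.im) (hη : η.im < 0)
    (hreg : ∀ j : ℕ, 1 ≤ j → ∀ l : ℤ, (j : ℂ) * τ + 4 * η ≠ (l : ℂ)) :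
    (∀ z μ : ℂ, ∃ F : ℂ → ℂ, HypTheta.IsContinuation z μ τ (τ - 2 * η * κ) F) ∧
    η ∈ HypTheta.regularSet τ (τ - 2 * η * κ) ∧
    ∀ f ∈ HypTheta.E κ (τ - 2 * η * κ) η,
      (∀ z : ℂ, MeasureTheory.Integrable
        (HypTheta.UIntegrand τ (τ - 2 * η * κ) η (HypTheta.alpha η f) z)) ∧
      HypTheta.T κ τ η f ∈ HypTheta.E κ τ η := by
  have hη0 : η ≠ 0 := by rintro rfl; simp at hη
  have hκ0 : 0 ≤ κ := by omega
  have hκ' : (4 : ℝ) ≤ κ := by exact_mod_cast hκ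
  have hσ : 0 < (τ - 2 * η * κ).im := by
    simp
    nlinarith
  have hmem := HypTheta.mem_regularSet hκ hτ hη hreg
  obtain ⟨C, hC⟩ := HypTheta.exists_isContinuation hτ hσ
  obtain ⟨Φ, hΦ⟩ := HypTheta.exists_isKernel hτ hσ hmem
  refine ⟨fun z μ => ⟨_, (hC z μ).choose_spec.1⟩, hmem, fun f hf => ?_⟩
  obtain ⟨h, hh, ho, hQ⟩ := HypTheta.exists_entire_Q_mul hσ hη0 hf
  have hae : ∀ z : ℂ, HypTheta.UIntegrand τ (τ - 2 * η * κ) η (HypTheta.alpha η f) z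
      =ᵐ[MeasureTheory.volume] fun x : ℝ => Complex.exp (Real.pi * Complex.I * z ^ 2 / (4 * η)) *
        η * HypTheta.gaussKernel η Φ h z (η * x) := by
    intro z
    filter_upwards [hQ] with x hx
    -- Completing the square. The factor exp(πi z²/4η) left over is removed by the outer α(z).
    have hexp : Complex.exp (-(Real.pi * Complex.I * z * (η * x) / (2 * η))) *
        Complex.exp (-(Real.pi * Complex.I * (-(η * x)) ^ 2 / (4 * η))) =
        Complex.exp (Real.pi * Complex.I * z ^ 2 / (4 * η)) *
          Complex.exp (-(Real.pi * Complex.I * (z + η * x) ^ 2 / (4 * η))) := by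
      rw [← Complex.exp_add, ← Complex.exp_add]
      congr 1
      field_simp
      ring
    simp only [HypTheta.UIntegrand, HypTheta.alpha, hΦ.u_eq, HypTheta.gaussKernel]
    rw [← hx]
    linear_combination (Φ z (η * x) * HypTheta.Q (η * x) (τ - 2 * η * κ) η * f (-(η * x)) * η) *
      hexp
  refine ⟨fun z => ((HypTheta.integrable_gaussKernel hτ hη hκ0 hΦ hh z).const_mul _).congr
    (hae z).symm, ?_⟩
  have hT : HypTheta.T κ τ η f = (-(Complex.exp (4 * Real.pi * Complex.I * η) /
      (2 * Real.pi * (4 * Complex.I * η) ^ (1 / 2 : ℂ))) * η) • HypTheta.gaussInt η Φ h := by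
    ext z
    rw [HypTheta.T, Pi.smul_apply, Pi.smul_apply, HypTheta.alpha, HypTheta.U,
      MeasureTheory.integral_congr_ae (hae z), MeasureTheory.integral_const_mul,
      ← HypTheta.gaussInt, smul_eq_mul, smul_eq_mul, Complex.exp_neg]
    have := Complex.exp_ne_zero (Real.pi * Complex.I * z ^ 2 / (4 * η))
    generalize Complex.exp (Real.pi * Complex.I * z ^ 2 / (4 * η)) = e at this ⊢
    rw [mul_assoc e, inv_mul_cancel_left₀ this]
    ring
  rw [hT]
  exact Submodule.smul_mem _ _ (HypTheta.gaussInt_mem_E hτ hη hκ0 hΦ hh ho)
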